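/- Let $f:\mathbb R^d\to\mathbb R$ be twice differentiable and bounded below, and suppose that, for some $L>0$, $\|\nabla f(x)-\nabla f(y)\|\le L\|x-y\|$ for all $x,y\in\mathbb R^d$. For $\nu\in[0,1]$ let $$H_\nu=\sup_{x\ne y}\frac{\|\nabla^2 f(x)-\nabla^2 f(y)\|}{\|x-y\|^\nu}\in[0,+\infty]$$ (operator norm). **Algorithm.** Inputs: $x_{\rm init}\in\mathbb R^d$, $\ell_{\rm init}>0$, $\alpha>1$, $0<\beta\le 1$. Start with $(x_0,v_0)=(x_{\rm init},0)$, $\ell=\ell_{\rm init}$, $k=0$, $K=0$, $h_0=0$, and repeat: increase $k$ and the total iteration count $K$ by one; set $$v_k=v_{k-1}-\tfrac1\ell\nabla f(x_{k-1}),\qquad x_k=x_{k-1}+v_k,\qquad \bar x_k=\frac1k\sum_{i=0}^{k-1}x_i,\qquad S_k=\sum_{i=1}^k\|v_i\|^2,$$ $$h_k=\max\Big\{h_{k-1},\ \tfrac{3}{\|v_k\|^2}\Big(f(x_k)-f(x_{k-1})-\tfrac12\langle\nabla f(x_{k-1})+\nabla f(x_k),v_k\rangle\Big),\ \sqrt{\tfrac{8}{kS_k}}\Big(\|\nabla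 f(\bar x_k)\|-\tfrac{\ell}{k}\|v_k\|\Big)\Big\}$$ (an entry with vanishing denominator is omitted), and let $x_k^\star$ be any minimizer of $f$ over $\{x_0,\dots,x_k,\bar x_1,\dots,\bar x_k\}$. - If $f(x_k)-f(x_{k-1})\le\langle\nabla f(x_{k-1}),v_k\rangle+\frac{\ell}{2}\|v_k\|^2$ fails, restart: $(x_0,v_0)\gets(x_k^\star,0)$, $\ell\gets\alpha\ell$, $k\gets0$. - Otherwise, if $k(k+1)h_k>\frac38\ell$, restart: $(x_0,v_0)\gets(x_k^\star,0)$, $\ell\gets\beta\ell$, $k\gets0$. The counter $K$ is never reset. Put $\bar\ell=\max\{\ell_{\rm init},\alpha L\}$, $\Delta=f(x_{\rm init})-\inf f$, $c_1=\log_\alpha(1/\beta)$, and $c_2=1+\log_\alpha(\bar\ell/\ell_{\rm init})$. **Theorem.** For every run of the algorithm and every $\epsilon>0$, there is an iteration at which $\|\nabla f(\bar x_k)\|\le\epsilon$, and at the first such iteration the total iteration count $K$ satisfies $$K\le\inf_{\nu\in[0,1]}\Big\{91(1+\sqrt{c_1})\,\Delta\sqrt{\bar\ell}\,H_\nu^{\frac1{2+2\nu}}\epsilon^{-\frac{4+3\nu}{2+2\nu}}+256\,c_1\Delta\,H_\nu^{\frac1{1+\nu}}\epsilon^{-\frac{2+\nu}{1+\nu}}\Big\}+6\sqrt{c_2\Delta\bar\ell}\,\epsilon^{-1}+c_2,$$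 where exponents $\nu$ with $H_\nu=+\infty$ do not contribute to the infimum. In particular, if $\beta=1$, then $c_1=0$ and $$K\le\inf_{\nu\in[0,1]}\Big\{91\,\Delta\sqrt{\bar\ell}\,H_\nu^{\frac1{2+2\nu}}\epsilon^{-\frac{4+3\nu}{2+2\nu}}\Big\}+6\sqrt{c_2\Delta\bar\ell}\,\epsilon^{-1}+c_2 .$$ Consequently the method, which does not use $\nu$, has complexity $O\big(H_\nu^{1/(2+2\nu)}\epsilon^{-(4+3\nu)/(2+2\nu)}\big)$ for all $\nu$ at once: there is a constant $C$ that depends only on $L,\ell_{\rm init},\alpha,\beta,\Delta$ such that, for every $\nu\in[0,1]$ with $0<H_\nu<+\infty$ and all sufficiently small $\epsilon>0$ (how small may depend on $f$, $\nu$ and the run), $K\le C\,H_\nu^{1/(2+2\nu)}\epsilon^{-(4+3\nu)/(2+2\nu)}$. -/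

import Mathlib

open scoped Gradient ENNReal

noncomputable section

namespace HeavyBall

variable {d : ℕ}

/-- The Hölder constant of the Hessian of `f` with exponent `ν`, a value in `[0, ∞]`: the supremum of
`‖∇²f x - ∇²f y‖ / ‖x - y‖ ^ ν` over `x ≠ y`. The Hessian is the derivative of the gradient, and
its norm is the operator norm. -/
def holderConst (f : EuclideanSpace ℝ (Fin d) → ℝ) (ν : ℝ) : ℝ≥0∞ :=
  ⨆ (x : EuclideanSpace ℝ (Fin d)) (y : EuclideanSpace ℝ (Fin d)) (_ : x ≠ y),
    ENNReal.ofReal (‖fderiv ℝ (∇ f) x - fderiv ℝ (∇ f) y‖ / ‖x - y‖ ^ ν)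

/-- The pair `(x_k, v_k)` of the epoch that starts at `x0` with the Lipschitz estimate `ell`:
`v_0 = 0`, `v_k = v_{k-1} - (1 / ell) ∇f(x_{k-1})`, `x_k = x_{k-1} + v_k`. -/
def iter (f : EuclideanSpace ℝ (Fin d) → ℝ) (ell : ℝ) (x0 : EuclideanSpace ℝ (Fin d)) :
    ℕ → EuclideanSpace ℝ (Fin d) × EuclideanSpace ℝ (Fin d)
  | 0 => (x0, 0)
  | k + 1 =>
      ((iter f ell x0 k).1 + ((iter f ell x0 k).2 - (1 / ell) • ∇ f (iter f ell x0 k).1),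
        (iter f ell x0 k).2 - (1 / ell) • ∇ f (iter f ell x0 k).1)

/-- The iterate `x_k` of the epoch. -/
def pos (f : EuclideanSpace ℝ (Fin d) → ℝ) (ell : ℝ) (x0 : EuclideanSpace ℝ (Fin d)) (k : ℕ) :
    EuclideanSpace ℝ (Fin d) :=
  (iter f ell x0 k).1

/-- The velocity `v_k` of the epoch. -/
def vel (f : EuclideanSpace ℝ (Fin d) → ℝ) (ell : ℝ) (x0 : EuclideanSpace ℝ (Fin d)) (k : ℕ) :
    EuclideanSpace ℝ (Fin d) :=
  (iter f ell x0 k).2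

/-- The averaged solution: the mean of `x_0, …, x_{k-1}` (used for `k ≥ 1` only). -/
def avg (f : EuclideanSpace ℝ (Fin d) → ℝ) (ell : ℝ) (x0 : EuclideanSpace ℝ (Fin d)) (k : ℕ) :
    EuclideanSpace ℝ (Fin d) :=
  (1 / (k : ℝ)) • ∑ i ∈ Finset.range k, pos f ell x0 i

/-- `S_k`, the sum of `‖v_i‖ ^ 2` over `1 ≤ i ≤ k`. -/
def sqSum (f : EuclideanSpace ℝ (Fin d) → ℝ) (ell : ℝ) (x0 : EuclideanSpace ℝ (Fin d)) (k : ℕ) : ℝ :=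
  ∑ i ∈ Finset.Icc 1 k, ‖vel f ell x0 i‖ ^ 2

/-- The estimate `h_k`, with `h_0 = 0`. An entry of the maximum whose denominator vanishes is `0`,
that is, it is left out, as `h_{k-1} ≥ 0`. -/
def holderEst (f : EuclideanSpace ℝ (Fin d) → ℝ) (ell : ℝ) (x0 : EuclideanSpace ℝ (Fin d)) : ℕ → ℝ
  | 0 => 0
  | k + 1 =>
      max (holderEst f ell x0 k)
        (max
          (3 / ‖vel f ell x0 (k + 1)‖ ^ 2 *
            (f (pos f ell x0 (k + 1)) - f (pos f ell x0 k) -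
              1 / 2 * inner ℝ (∇ f (pos f ell x0 k) + ∇ f (pos f ell x0 (k + 1)))
                (vel f ell x0 (k + 1))))
          (√(8 / (((k + 1 : ℕ) : ℝ) * sqSum f ell x0 (k + 1))) *
            (‖∇ f (avg f ell x0 (k + 1))‖ -
              ell / ((k + 1 : ℕ) : ℝ) * ‖vel f ell x0 (k + 1)‖)))

/-- The descent condition at iteration `k ≥ 1` of the epoch. -/
def Descent (f : EuclideanSpace ℝ (Fin d) → ℝ) (ell : ℝ) (x0 : EuclideanSpace ℝ (Fin d)) (k : ℕ) :
    Prop :=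
  f (pos f ell x0 k) - f (pos f ell x0 (k - 1)) ≤
    inner ℝ (∇ f (pos f ell x0 (k - 1))) (vel f ell x0 k) + ell / 2 * ‖vel f ell x0 k‖ ^ 2

/-- The condition `k (k + 1) h_k > (3 / 8) ell` for the second kind of restart. -/
def LargeK (f : EuclideanSpace ℝ (Fin d) → ℝ) (ell : ℝ) (x0 : EuclideanSpace ℝ (Fin d)) (k : ℕ) :
    Prop :=
  (k : ℝ) * ((k : ℝ) + 1) * holderEst f ell x0 k > 3 / 8 * ell

/-- The candidates `x_0, …, x_k` and the averages number `1, …, k` of the epoch. -/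
def candidates (f : EuclideanSpace ℝ (Fin d) → ℝ) (ell : ℝ) (x0 : EuclideanSpace ℝ (Fin d)) (k : ℕ) :
    Set (EuclideanSpace ℝ (Fin d)) :=
  pos f ell x0 '' Set.Iic k ∪ avg f ell x0 '' Set.Icc 1 k

/-- `y` is a best solution at iteration `k` of the epoch: a minimizer of `f` over the candidates.
Ties may be broken arbitrarily. -/
def IsBest (f : EuclideanSpace ℝ (Fin d) → ℝ) (ell : ℝ) (x0 : EuclideanSpace ℝ (Fin d)) (k : ℕ)
    (y : EuclideanSpace ℝ (Fin d)) : Prop :=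
  y ∈ candidates f ell x0 k ∧ ∀ z ∈ candidates f ell x0 k, f y ≤ f z

/-- The state between two passes through the loop: the starting point and the Lipschitz estimate of
the current epoch, and the iteration counter `k`. They determine all of `x_i`, `v_i`, `h_i` and
the averages in the current epoch. -/
structure State (d : ℕ) where
  x0 : EuclideanSpace ℝ (Fin d)
  ell : ℝ
  k : ℕ

/-- One pass through the loop, which performs iteration `s.k + 1` of the current epoch. -/
inductive Step (f : EuclideanSpace ℝ (Fin d) → ℝ) (α β : ℝ) : State d → State d → Prop
  | unsuccessful (s : State d) (y : EuclideanSpace ℝ (Fin d))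
      (hy : IsBest f s.ell s.x0 (s.k + 1) y)
      (hdesc : ¬ Descent f s.ell s.x0 (s.k + 1)) :
      Step f α β s ⟨y, α * s.ell, 0⟩
  | successful (s : State d) (y : EuclideanSpace ℝ (Fin d))
      (hy : IsBest f s.ell s.x0 (s.k + 1) y)
      (hdesc : Descent f s.ell s.x0 (s.k + 1))
      (hlarge : LargeK f s.ell s.x0 (s.k + 1)) :
      Step f α β s ⟨y, β * s.ell, 0⟩
  | proceed (s : State d)
      (hdesc : Descent f s.ell s.x0 (s.k + 1))
      (hlarge : ¬ LargeK f s.ell s.x0 (s.k + 1)) :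
      Step f α β s ⟨s.x0, s.ell, s.k + 1⟩

/-- A run of the algorithm without a stopping test; `s K` is the state after `K` passes through
the loop, so that the index is the total iteration count. -/
structure IsRun (f : EuclideanSpace ℝ (Fin d) → ℝ) (xInit : EuclideanSpace ℝ (Fin d))
    (ellInit α β : ℝ) (s : ℕ → State d) : Prop where
  init : s 0 = ⟨xInit, ellInit, 0⟩
  step : ∀ K, Step f α β (s K) (s (K + 1))

/-- The average computed in pass number `K ≥ 1` through the loop; that pass starts from the state
`s (K - 1)` and raises its counter by one. -/
def runAvg (f : EuclideanSpace ℝ (Fin d) → ℝ) (s : ℕ → State d) (K : ℕ) :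
    EuclideanSpace ℝ (Fin d) :=
  avg f (s (K - 1)).ell (s (K - 1)).x0 ((s (K - 1)).k + 1)

/-- `K` is the total iteration count when the gradient norm at the average is at most `ε` for the
first time. -/
def IsFirstHit (f : EuclideanSpace ℝ (Fin d) → ℝ) (s : ℕ → State d) (ε : ℝ) (K : ℕ) : Prop :=
  IsLeast {J : ℕ | 1 ≤ J ∧ ‖∇ f (runAvg f s J)‖ ≤ ε} K

/-- The initial gap `Δ`. -/
def gap (f : EuclideanSpace ℝ (Fin d) → ℝ) (xInit : EuclideanSpace ℝ (Fin d)) : ℝ :=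
  f xInit - ⨅ x, f x

/-- The upper bound `max {ellInit, α L}` on the Lipschitz estimates. -/
def ellBar (ellInit α L : ℝ) : ℝ := max ellInit (α * L)

def c₁ (α β : ℝ) : ℝ := Real.logb α (1 / β)

def c₂ (ellInit α L : ℝ) : ℝ := 1 + Real.logb α (ellBar ellInit α L / ellInit)

end HeavyBall

end

/-!
Write `D = f(x_0) - f(x⋆)` for the decrease of the objective over an epoch of length `k`, where `x⋆`
is the best candidate found.

*Decrease.* Since `∇f(x_j) = ℓ (v_j - v_{j+1})`, the trapezoidal bounds that define `h_k` telescope to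
`f(x_j) - f(x_0) ≤ -(ℓ/2)⟨v_j, v_{j+1}⟩ + (h_j/3) S_j`. Twice this plus the descent condition at
`j + 1` cancels the inner product (`le_decrease_of_descent`). The mean over all `j` gives
`D ≥ (3/16) ℓ S_k / k` as long as `k (k - 1) h_{k-1} ≤ (3/8) ℓ`, that is, up to the last iteration of
an epoch (`sqSum_le_decrease`).
The other entry of the maximum bounds the gradient at the average by `(ℓ/j)‖v_j‖` plus a
negligible term; so if no such gradient is below `ε`, then `S_k` is at least of the order of
`k³ ε² / ℓ²`, and `D` of the order of `k² ε² / ℓ` (`Unfinished.sq_le_decrease`,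
`Unfinished.sq_succ_le_decrease`).

*Successful epochs.* These end with `k² h_k ≥ (3/16) ℓ`, while `h_k ≤ H_ν (k S_k)^(ν/2)`
(`holderEst_le`). The latter rests on two inequalities that do not mention the Hessian
(`trapezoid_error_le`, `norm_gradient_mean_sub_le`) and on the bound `k S_k / 8` for the mean squared
deviation of the iterates from their average (`mean_sq_deviation_le`). The length scale `k S_k` and
the ratio `ℓ / k²` can be eliminated from the three inequalities, which leaves `D ≥ c / G` with
`G = H_ν^(1/(1+ν)) ε^(-(2+ν)/(1+ν))` (`one_le_mul_epochRate`). This holds for every `ν`,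
although the method does not know `ν`. So there are `O(Δ G)` successful epochs, and as
`k² ε² ≤ 38 ℓ D`, their total length is `O(Δ √(ℓ G) / ε)`.

*Unsuccessful epochs.* Each multiplies the estimate `ℓ ≤ max (ℓ_init, α L)` by `α`, so together with
the current epoch there are at most `c₂ + c₁ N` of them, where `N` is the number of successful epochs.
By Cauchy–Schwarz, their total length, one iteration of each set apart, is at most the root of this
number times the sum of the squared lengths, which the decrease bounds by `O(Δ ℓ / ε²)`. The
structure `Ledger` keeps these accounts along a run, and `Ledger.succ_le_iterationBound` evaluates
them.

A gradient of norm at most `ε` is reached at all because `H_0 ≤ 2 L` is finite.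
-/

namespace HeavyBall

/-! ### Mean squared deviation of a trajectory -/

section Deviation

variable {E : Type*} [NormedAddCommGroup E] [InnerProductSpace ℝ E]

theorem sum_sub_mean_eq_zero (z : ℕ → E) {k : ℕ} (hk : 0 < k) (m : E)
    (hm : m = (1 / (k : ℝ)) • ∑ j ∈ Finset.range k, z j) :
    ∑ j ∈ Finset.range k, (z j - m) = 0 := by
  have hk' : (k : ℝ) ≠ 0 := by exact_mod_cast hk.ne'
  rw [Finset.sum_sub_distrib, Finset.sum_const, Finset.card_range, hm, ← Nat.cast_smul_eq_nsmul ℝ,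
    smul_smul, mul_one_div_cancel hk', one_smul, sub_self]

/-- The sum over all ordered pairs is `2 k` times the sum of the squared deviations from the mean. -/
theorem sum_sum_norm_sub_sq (z : ℕ → E) {k : ℕ} (hk : 0 < k) (m : E)
    (hm : m = (1 / (k : ℝ)) • ∑ j ∈ Finset.range k, z j) :
    ∑ a ∈ Finset.range k, ∑ b ∈ Finset.range k, ‖z a - z b‖ ^ 2 =
      2 * k * ∑ j ∈ Finset.range k, ‖z j - m‖ ^ 2 := by
  have hzero : ∑ j ∈ Finset.range k, (z j - m) = 0 := sum_sub_mean_eq_zero z hk m hm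
  have e : ∀ a b, ‖z a - z b‖ ^ 2 =
      ‖z a - m‖ ^ 2 - 2 * inner ℝ (z a - m) (z b - m) + ‖z b - m‖ ^ 2 := by
    intro a b
    rw [← norm_sub_sq_real, sub_sub_sub_cancel_right]
  simp only [e, Finset.sum_add_distrib, Finset.sum_sub_distrib, ← Finset.mul_sum, ← inner_sum,
    ← sum_inner, hzero, inner_zero_left, Finset.sum_const, Finset.card_range, nsmul_eq_mul]
  ring

theorem sum_sum_eq_two_mul_of_symm (g : ℕ → ℕ → ℝ) (hs : ∀ a b, g a b = g b a)
    (h0 : ∀ a, g a a = 0) (k : ℕ) :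
    ∑ a ∈ Finset.range k, ∑ b ∈ Finset.range k, g a b =
      2 * ∑ b ∈ Finset.range k, ∑ a ∈ Finset.range b, g a b := by
  induction k with
  | zero => simp
  | succ k ih =>
    have h : ∑ b ∈ Finset.range k, g k b = ∑ a ∈ Finset.range k, g a k :=
      Finset.sum_congr rfl fun b _ => hs k b
    simp only [Finset.sum_range_succ, Finset.sum_add_distrib, ih, h, h0]
    ring

/-- The total length of the index intervals `(a, b]` with `b < k` that contain `j`. -/
theorem sum_length_intervals (j n : ℕ) :
    ∑ b ∈ Finset.range (j + n), ∑ a ∈ Finset.range b,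
      (if a < j ∧ j ≤ b then (b : ℝ) - a else 0) = j * n * (j + n) / 2 := by
  induction n with
  | zero =>
    rw [add_zero, Finset.sum_eq_zero]
    · simp
    · intro b hb
      refine Finset.sum_eq_zero fun a _ => if_neg ?_
      rw [Finset.mem_range] at hb
      omega
  | succ n ih =>
    have aux : ∀ i : ℕ, ∑ a ∈ Finset.range i, ((j : ℝ) + n - a) = i * (j + n) - i * (i - 1) / 2 := by
      intro i
      induction i with
      | zero => simp
      | succ i ih => rw [Finset.sum_range_succ, ih]; push_cast; ring
    have h : ∑ a ∈ Finset.range (j + n), (if a < j ∧ j ≤ j + n then ((j + n : ℕ) : ℝ) - a else 0) =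
        ∑ a ∈ Finset.range j, ((j : ℝ) + n - a) := by
      rw [← Finset.sum_filter]
      refine Finset.sum_congr ?_ fun a _ => by push_cast; ring
      ext a
      simp only [Finset.mem_filter, Finset.mem_range]
      omega
    rw [← add_assoc, Finset.sum_range_succ, ih, h, aux]
    push_cast
    ring

/-- A trajectory with increments `v` deviates from its mean by at most `k / 8` times the sum of the
squared increments, in the mean square. -/
theorem mean_sq_deviation_le (z v : ℕ → E) (hz : ∀ j, z (j + 1) = z j + v (j + 1)) {k : ℕ}
    (hk : 0 < k) (m : E) (hm : m = (1 / (k : ℝ)) • ∑ j ∈ Finset.range k, z j) :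
    1 / (k : ℝ) * ∑ j ∈ Finset.range k, ‖z j - m‖ ^ 2 ≤
      k * (∑ i ∈ Finset.Icc 1 k, ‖v i‖ ^ 2) / 8 := by
  have hk' : (0 : ℝ) < k := by exact_mod_cast hk
  have hpath : ∀ a n, z (a + n) - z a = ∑ i ∈ Finset.Ioc a (a + n), v i := by
    intro a n
    induction n with
    | zero => simp
    | succ n ih =>
      rw [← add_assoc, hz, Finset.sum_Ioc_succ_top (by omega), ← ih]; abel
  have hpair : ∀ a b, b < k → a < b → ‖z a - z b‖ ^ 2 ≤
      ∑ i ∈ Finset.Icc 1 k, ‖v i‖ ^ 2 * (if a < i ∧ i ≤ b then (b : ℝ) - a else 0) := by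
    intro a b hb hab
    obtain ⟨n, rfl⟩ := Nat.exists_eq_add_of_le hab.le
    rw [norm_sub_rev, hpath]
    have h1 : ‖∑ i ∈ Finset.Ioc a (a + n), v i‖ ^ 2 ≤
        n * ∑ i ∈ Finset.Ioc a (a + n), ‖v i‖ ^ 2 := by
      have := sq_sum_le_card_mul_sum_sq (s := Finset.Ioc a (a + n)) (f := fun i => ‖v i‖)
      simp only [Nat.card_Ioc, add_tsub_cancel_left] at this
      refine le_trans ?_ this
      gcongr
      exact norm_sum_le _ _
    refine h1.trans_eq ?_
    simp only [mul_ite, mul_zero]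
    rw [← Finset.sum_filter, Finset.mul_sum]
    refine Finset.sum_congr ?_ fun i _ => by push_cast; ring
    ext i
    simp only [Finset.mem_filter, Finset.mem_Icc, Finset.mem_Ioc]
    omega
  have hT : ∑ b ∈ Finset.range k, ∑ a ∈ Finset.range b, ‖z a - z b‖ ^ 2 ≤
      ∑ i ∈ Finset.Icc 1 k, ‖v i‖ ^ 2 * ((k : ℝ) ^ 3 / 8) := by
    calc _ ≤ ∑ b ∈ Finset.range k, ∑ a ∈ Finset.range b, ∑ i ∈ Finset.Icc 1 k,
          ‖v i‖ ^ 2 * (if a < i ∧ i ≤ b then (b : ℝ) - a else 0) := by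
          refine Finset.sum_le_sum fun b hb => Finset.sum_le_sum fun a ha => ?_
          exact hpair a b (Finset.mem_range.1 hb) (Finset.mem_range.1 ha)
      _ = ∑ i ∈ Finset.Icc 1 k, ‖v i‖ ^ 2 * ∑ b ∈ Finset.range k, ∑ a ∈ Finset.range b,
          (if a < i ∧ i ≤ b then (b : ℝ) - a else 0) := by
          simp only [Finset.mul_sum]
          rw [Finset.sum_comm]
          simp only [Finset.sum_comm (s := Finset.range _) (t := Finset.Icc 1 k)]
      _ ≤ _ := by
          refine Finset.sum_le_sum fun i hi => ?_
          obtain ⟨n, hn⟩ := Nat.exists_eq_add_of_le (Finset.mem_Icc.1 hi).2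
          gcongr
          rw [hn, sum_length_intervals]
          push_cast
          -- `i n ≤ (i + n)² / 4`
          have := mul_nonneg (sq_nonneg ((i : ℝ) - n)) (by positivity : (0 : ℝ) ≤ i + n)
          nlinarith
  rw [← Finset.sum_mul] at hT
  have h2 := sum_sum_norm_sub_sq z hk m hm
  rw [sum_sum_eq_two_mul_of_symm (fun a b => ‖z a - z b‖ ^ 2)
    (fun a b => by rw [norm_sub_rev]) (fun a => by simp)] at h2
  set V := ∑ j ∈ Finset.range k, ‖z j - m‖ ^ 2
  set S := ∑ i ∈ Finset.Icc 1 k, ‖v i‖ ^ 2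
  rw [one_div, inv_mul_le_iff₀ hk']
  have h3 : k * V ≤ k * (k * (k * S / 8)) := by nlinarith
  exact le_of_mul_le_mul_left h3 hk'

end Deviation

/-! ### Inequalities for functions with a Hölder continuous Hessian -/

section Calculus

variable {E : Type*} [NormedAddCommGroup E] [InnerProductSpace ℝ E] [CompleteSpace E]

/-- The Hessian of `f` is Hölder continuous with exponent `ν` and the finite constant `H`. -/
def HolderHessian (f : E → ℝ) (H ν : ℝ) : Prop :=
  ∀ x y, ‖fderiv ℝ (∇ f) x - fderiv ℝ (∇ f) y‖ ≤ H * ‖x - y‖ ^ ν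

theorem hasDerivAt_comp_line {f : E → ℝ} (hf : Differentiable ℝ f) (x v : E) (t : ℝ) :
    HasDerivAt (fun t : ℝ => f (x + t • v)) (inner ℝ (∇ f (x + t • v)) v) t := by
  have h1 : HasDerivAt (fun t : ℝ => x + t • v) v t := by
    simpa using ((hasDerivAt_id t).smul_const v).const_add x
  exact (hf (x + t • v)).hasGradientAt.hasFDerivAt.comp_hasDerivAt t h1

theorem hasDerivAt_inner_gradient_comp_line {f : E → ℝ} (hg : Differentiable ℝ (∇ f)) (x v : E)
    (t : ℝ) :
    HasDerivAt (fun t : ℝ => (inner ℝ (∇ f (x + t • v)) v : ℝ))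
      (inner ℝ (fderiv ℝ (∇ f) (x + t • v) v) v) t := by
  have h1 : HasDerivAt (fun t : ℝ => x + t • v) v t := by
    simpa using ((hasDerivAt_id t).smul_const v).const_add x
  have h2 := (hg (x + t • v)).hasFDerivAt.comp_hasDerivAt t h1
  simpa using h2.inner ℝ (hasDerivAt_const t v)

/-- The error of the trapezoidal rule along a segment. The constant `1 / 4` is not optimal, but it
stays below the factor `1 / 3` that the estimate `holderEst` allows. -/
theorem trapezoid_error_le {f : E → ℝ} (hf : Differentiable ℝ f) (hg : Differentiable ℝ (∇ f))
    {H ν : ℝ} (hν : 0 ≤ ν) (hH0 : 0 ≤ H) (hH : HolderHessian f H ν) (x v : E) :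
    f (x + v) - f x - 1 / 2 * inner ℝ (∇ f x + ∇ f (x + v)) v ≤
      H / 4 * (‖v‖ ^ 2 * ‖v‖ ^ ν) := by
  set φ : ℝ → ℝ := fun t => f (x + t • v) with hφ
  set ψ : ℝ → ℝ := fun t => inner ℝ (∇ f (x + t • v)) v with hψ
  set χ : ℝ → ℝ := fun t => inner ℝ (fderiv ℝ (∇ f) (x + t • v) v) v with hχ
  set M : ℝ := H * (‖v‖ ^ 2 * ‖v‖ ^ ν) with hM
  have dφ : ∀ t, HasDerivAt φ (ψ t) t := hasDerivAt_comp_line hf x v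
  have dψ : ∀ t, HasDerivAt ψ (χ t) t := hasDerivAt_inner_gradient_comp_line hg x v
  have osc : ∀ s t : ℝ, |s - t| ≤ 1 → χ s - χ t ≤ M := by
    intro s t hst
    have e : χ s - χ t =
        inner ℝ ((fderiv ℝ (∇ f) (x + s • v) - fderiv ℝ (∇ f) (x + t • v)) v) v := by
      simp [hχ, inner_sub_left]
    have hn : ‖(x + s • v) - (x + t • v)‖ ≤ ‖v‖ := by
      have : (x + s • v) - (x + t • v) = (s - t) • v := by module
      rw [this, norm_smul, Real.norm_eq_abs]
      exact mul_le_of_le_one_left (norm_nonneg _) hst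
    rw [e]
    calc _ ≤ ‖(fderiv ℝ (∇ f) (x + s • v) - fderiv ℝ (∇ f) (x + t • v)) v‖ * ‖v‖ :=
          real_inner_le_norm _ _
      _ ≤ (‖fderiv ℝ (∇ f) (x + s • v) - fderiv ℝ (∇ f) (x + t • v)‖ * ‖v‖) * ‖v‖ := by
          gcongr; exact ContinuousLinearMap.le_opNorm _ _
      _ ≤ (H * ‖v‖ ^ ν * ‖v‖) * ‖v‖ := by
          gcongr
          refine (hH _ _).trans ?_
          gcongr
      _ = M := by rw [hM]; ring
  set g : ℝ → ℝ := fun t => M / 4 * t ^ 2 - (φ t - φ 0 - t / 2 * (ψ 0 + ψ t)) with hgdef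
  have dg : ∀ t, HasDerivAt g (M / 2 * t - (ψ t - (1 / 2 * (ψ 0 + ψ t) + t / 2 * χ t))) t := by
    intro t
    have h1 : HasDerivAt (fun t : ℝ => M / 4 * t ^ 2) (M / 2 * t) t := by
      refine ((hasDerivAt_pow 2 t).const_mul (M / 4)).congr_deriv ?_
      norm_num
      ring
    have h2 : HasDerivAt (fun t : ℝ => t / 2 * (ψ 0 + ψ t)) (1 / 2 * (ψ 0 + ψ t) + t / 2 * χ t) t :=
      ((hasDerivAt_id t).div_const 2).mul ((dψ t).const_add (ψ 0))
    exact h1.sub (((dφ t).sub_const (φ 0)).sub h2)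
  have mono : MonotoneOn g (Set.Icc 0 1) := by
    refine monotoneOn_of_deriv_nonneg (convex_Icc 0 1)
      (fun t _ => (dg t).continuousAt.continuousWithinAt)
      (fun t _ => (dg t).differentiableAt.differentiableWithinAt) ?_
    intro t ht
    rw [interior_Icc] at ht
    obtain ⟨ht0, ht1⟩ := ht
    rw [(dg t).deriv]
    obtain ⟨ξ, hξ, hs⟩ := exists_hasDerivAt_eq_slope ψ χ ht0
      (fun u _ => (dψ u).continuousAt.continuousWithinAt) (fun u _ => dψ u)
    rw [sub_zero, eq_div_iff ht0.ne'] at hs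
    have ho := osc ξ t (by rw [abs_le]; constructor <;> linarith [hξ.1, hξ.2])
    have := mul_le_mul_of_nonneg_left ho ht0.le
    nlinarith
  have h01 := mono (Set.left_mem_Icc.2 zero_le_one) (Set.right_mem_Icc.2 zero_le_one) zero_le_one
  simp only [hgdef, hφ, hψ, zero_smul, add_zero, one_smul] at h01
  rw [inner_add_left]
  rw [hM] at h01
  linarith

theorem norm_gradient_sub_linear_le {f : E → ℝ} (hg : Differentiable ℝ (∇ f))
    {H ν : ℝ} (hν : 0 ≤ ν) (hH0 : 0 ≤ H) (hH : HolderHessian f H ν) (x y : E) :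
    ‖∇ f y - ∇ f x - fderiv ℝ (∇ f) x (y - x)‖ ≤ H * ‖y - x‖ ^ (1 + ν) := by
  have := (convex_segment (𝕜 := ℝ) x y).norm_image_sub_le_of_norm_fderiv_le' (f := ∇ f)
    (φ := fderiv ℝ (∇ f) x) (C := H * ‖y - x‖ ^ ν) (𝕜 := ℝ) (fun z _ => hg z)
    (fun z hz => by
      refine (hH z x).trans ?_
      gcongr
      exact norm_sub_le_of_mem_segment hz)
    (left_mem_segment ℝ x y) (right_mem_segment ℝ x y)
  refine this.trans_eq ?_
  rw [mul_assoc]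
  congr 1
  rcases eq_or_lt_of_le (norm_nonneg (y - x)) with h | h
  · rw [← h, mul_zero, Real.zero_rpow (by linarith)]
  · rw [Real.rpow_add h, Real.rpow_one, mul_comm]

/-- The gradient at a mean against the mean of the gradients: the linear terms of the expansions at
the mean cancel, and the remainders are controlled by the mean squared deviation. -/
theorem norm_gradient_mean_sub_le {f : E → ℝ} (hg : Differentiable ℝ (∇ f))
    {H ν : ℝ} (hν : 0 ≤ ν) (hν1 : ν ≤ 1) (hH0 : 0 ≤ H) (hH : HolderHessian f H ν)
    (z : ℕ → E) {k : ℕ} (hk : 0 < k) (m : E) (hm : m = (1 / (k : ℝ)) • ∑ j ∈ Finset.range k, z j) :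
    ‖∇ f m - (1 / (k : ℝ)) • ∑ j ∈ Finset.range k, ∇ f (z j)‖ ≤
      H * (1 / (k : ℝ) * ∑ j ∈ Finset.range k, ‖z j - m‖ ^ 2) ^ ((1 + ν) / 2) := by
  have hk' : (0 : ℝ) < k := by exact_mod_cast hk
  have hzero : ∑ j ∈ Finset.range k, (z j - m) = 0 := sum_sub_mean_eq_zero z hk m hm
  have e : ∇ f m - (1 / (k : ℝ)) • ∑ j ∈ Finset.range k, ∇ f (z j) =
      -((1 / (k : ℝ)) • ∑ j ∈ Finset.range k,
        (∇ f (z j) - ∇ f m - fderiv ℝ (∇ f) m (z j - m))) := by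
    rw [Finset.sum_sub_distrib, Finset.sum_sub_distrib, ← map_sum, hzero, map_zero,
      Finset.sum_const, Finset.card_range, sub_zero, smul_sub, ← Nat.cast_smul_eq_nsmul ℝ,
      smul_smul, one_div_mul_cancel hk'.ne', one_smul]
    abel
  rw [e, norm_neg, norm_smul, Real.norm_of_nonneg (by positivity)]
  have h1 : ‖∑ j ∈ Finset.range k, (∇ f (z j) - ∇ f m - fderiv ℝ (∇ f) m (z j - m))‖ ≤
      ∑ j ∈ Finset.range k, H * ‖z j - m‖ ^ (1 + ν) :=
    (norm_sum_le _ _).trans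
      (Finset.sum_le_sum fun j _ => norm_gradient_sub_linear_le hg hν hH0 hH m (z j))
  have h2 : ∑ j ∈ Finset.range k, 1 / (k : ℝ) * ‖z j - m‖ ^ (1 + ν) ≤
      (1 / (k : ℝ) * ∑ j ∈ Finset.range k, ‖z j - m‖ ^ 2) ^ ((1 + ν) / 2) := by
    have h3 := Real.rpow_arith_mean_le_arith_mean_rpow (Finset.range k) (fun _ => 1 / (k : ℝ))
      (fun j => ‖z j - m‖ ^ (1 + ν)) (fun _ _ => by positivity)
      (by simp [hk'.ne']) (fun _ _ => by positivity) (p := 2 / (1 + ν))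
      (by rw [le_div_iff₀ (by linarith)]; linarith)
    have h4 : ∀ j, (‖z j - m‖ ^ (1 + ν)) ^ (2 / (1 + ν)) = ‖z j - m‖ ^ 2 := by
      intro j
      rw [← Real.rpow_mul (norm_nonneg _), mul_div_cancel₀ _ (by linarith : (1 + ν) ≠ 0)]
      norm_num
    simp only [h4] at h3
    rw [← Finset.mul_sum] at h3 ⊢
    have h5 := Real.rpow_le_rpow (by positivity) h3 (z := (1 + ν) / 2) (by linarith)
    rwa [← Finset.mul_sum, ← Real.rpow_mul (by positivity), div_mul_div_cancel₀ (by linarith : (1 + ν) ≠ 0),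
      div_self two_ne_zero, Real.rpow_one] at h5
  calc 1 / (k : ℝ) * ‖∑ j ∈ Finset.range k, (∇ f (z j) - ∇ f m - fderiv ℝ (∇ f) m (z j - m))‖
      ≤ 1 / (k : ℝ) * ∑ j ∈ Finset.range k, H * ‖z j - m‖ ^ (1 + ν) := by gcongr
    _ = H * ∑ j ∈ Finset.range k, 1 / (k : ℝ) * ‖z j - m‖ ^ (1 + ν) := by
        rw [← Finset.mul_sum, ← Finset.mul_sum]; ring
    _ ≤ _ := by gcongr

end Calculus

/-! ### The iterates of an epoch and the estimate of the Hölder constant -/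

section Epoch

variable {d : ℕ} (f : EuclideanSpace ℝ (Fin d) → ℝ) (ell : ℝ) (x0 : EuclideanSpace ℝ (Fin d))

@[simp] theorem pos_zero : pos f ell x0 0 = x0 := rfl

@[simp] theorem vel_zero : vel f ell x0 0 = 0 := rfl

@[simp] theorem holderEst_zero : holderEst f ell x0 0 = 0 := rfl

theorem pos_succ (k : ℕ) : pos f ell x0 (k + 1) = pos f ell x0 k + vel f ell x0 (k + 1) := rfl

theorem vel_succ (k : ℕ) :
    vel f ell x0 (k + 1) = vel f ell x0 k - (1 / ell) • ∇ f (pos f ell x0 k) := rfl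

variable {ell} in
theorem gradient_pos (hell : 0 < ell) (k : ℕ) :
    ∇ f (pos f ell x0 k) = ell • (vel f ell x0 k - vel f ell x0 (k + 1)) := by
  rw [vel_succ, sub_sub_cancel, smul_smul, mul_one_div_cancel hell.ne', one_smul]

variable {ell} in
theorem sum_gradient_pos (hell : 0 < ell) (k : ℕ) :
    ∑ i ∈ Finset.range k, ∇ f (pos f ell x0 i) = -(ell • vel f ell x0 k) := by
  simp only [gradient_pos f x0 hell, ← Finset.smul_sum, Finset.sum_range_sub', vel_zero, zero_sub,
    smul_neg]

@[simp] theorem avg_one : avg f ell x0 1 = x0 := by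
  simp [avg]

theorem sqSum_succ (k : ℕ) :
    sqSum f ell x0 (k + 1) = sqSum f ell x0 k + ‖vel f ell x0 (k + 1)‖ ^ 2 :=
  Finset.sum_Icc_succ_top (by omega) _

theorem sqSum_mono : Monotone (sqSum f ell x0) :=
  monotone_nat_of_le_succ fun k => by rw [sqSum_succ]; exact le_add_of_nonneg_right (by positivity)

theorem sqSum_nonneg (k : ℕ) : 0 ≤ sqSum f ell x0 k :=
  Finset.sum_nonneg fun _ _ => by positivity

theorem sq_norm_vel_le_sqSum {j k : ℕ} (hj : 1 ≤ j) (hjk : j ≤ k) :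
    ‖vel f ell x0 j‖ ^ 2 ≤ sqSum f ell x0 k :=
  Finset.single_le_sum (f := fun i => ‖vel f ell x0 i‖ ^ 2) (fun _ _ => by positivity)
    (Finset.mem_Icc.2 ⟨hj, hjk⟩)

theorem holderEst_mono : Monotone (holderEst f ell x0) :=
  monotone_nat_of_le_succ fun _ => le_max_left _ _

theorem holderEst_nonneg (k : ℕ) : 0 ≤ holderEst f ell x0 k :=
  holderEst_mono f ell x0 (Nat.zero_le k)

/-- The first kind of entry in the maximum makes `holderEst` a bound for the trapezoidal error. -/
theorem sub_le_of_holderEst (k : ℕ) :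
    f (pos f ell x0 (k + 1)) - f (pos f ell x0 k) ≤
      1 / 2 * inner ℝ (∇ f (pos f ell x0 k) + ∇ f (pos f ell x0 (k + 1))) (vel f ell x0 (k + 1)) +
        holderEst f ell x0 (k + 1) / 3 * ‖vel f ell x0 (k + 1)‖ ^ 2 := by
  set v := vel f ell x0 (k + 1) with hv
  rcases eq_or_ne v 0 with h0 | h0
  · rw [pos_succ, ← hv, h0]; simp
  have hv0 : 0 < ‖v‖ ^ 2 := by positivity
  have h : 3 / ‖v‖ ^ 2 * (f (pos f ell x0 (k + 1)) - f (pos f ell x0 k) -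
      1 / 2 * inner ℝ (∇ f (pos f ell x0 k) + ∇ f (pos f ell x0 (k + 1))) v) ≤
      holderEst f ell x0 (k + 1) :=
    (le_max_left _ _).trans (le_max_right _ _)
  rw [div_mul_eq_mul_div, div_le_iff₀ hv0] at h
  linarith

/-- The second kind of entry in the maximum makes `holderEst` control the gradient at the average. -/
theorem norm_gradient_avg_le_of_holderEst {k : ℕ} (hS : 0 < sqSum f ell x0 (k + 1)) :
    ‖∇ f (avg f ell x0 (k + 1))‖ ≤ ell / ((k + 1 : ℕ) : ℝ) * ‖vel f ell x0 (k + 1)‖ +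
      holderEst f ell x0 (k + 1) * √(((k + 1 : ℕ) : ℝ) * sqSum f ell x0 (k + 1) / 8) := by
  have hk : (0 : ℝ) < ((k + 1 : ℕ) : ℝ) := by positivity
  set S := sqSum f ell x0 (k + 1)
  have h : √(8 / (((k + 1 : ℕ) : ℝ) * S)) * (‖∇ f (avg f ell x0 (k + 1))‖ -
      ell / ((k + 1 : ℕ) : ℝ) * ‖vel f ell x0 (k + 1)‖) ≤ holderEst f ell x0 (k + 1) :=
    (le_max_right _ _).trans (le_max_right _ _)
  have hr : 0 < √(((k + 1 : ℕ) : ℝ) * S / 8) := Real.sqrt_pos.2 (by positivity)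
  rw [← inv_div, Real.sqrt_inv, inv_mul_le_iff₀ hr] at h
  linarith

/-- The estimate `holderEst` does not exceed the Hölder constant by more than the power of the
length scale of the epoch that the exponent `ν` demands. -/
theorem holderEst_le {ell : ℝ} (hf : Differentiable ℝ f) (hg : Differentiable ℝ (∇ f))
    {H ν : ℝ} (hν : 0 ≤ ν) (hν1 : ν ≤ 1) (hH0 : 0 ≤ H) (hH : HolderHessian f H ν)
    (hell : 0 < ell) (k : ℕ) :
    holderEst f ell x0 k ≤ H * (k * sqSum f ell x0 k) ^ (ν / 2) := by
  induction k with
  | zero => simpa using mul_nonneg hH0 (Real.rpow_nonneg le_rfl _)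
  | succ k ih =>
    set v := vel f ell x0 (k + 1) with hv
    set S := sqSum f ell x0 (k + 1) with hSdef
    have hS0 : 0 ≤ S := sqSum_nonneg _ _ _ _
    have hk : (0 : ℝ) < ((k + 1 : ℕ) : ℝ) := by positivity
    have hk1 : (1 : ℝ) ≤ ((k + 1 : ℕ) : ℝ) := by exact_mod_cast Nat.le_add_left 1 k
    refine max_le ?_ (max_le ?_ ?_)
    · refine ih.trans ?_
      have := sqSum_nonneg f ell x0 k
      gcongr
      · exact Nat.le_succ k
      · exact sqSum_mono f ell x0 (Nat.le_succ k)
    · have h1 : f (pos f ell x0 (k + 1)) - f (pos f ell x0 k) -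
          1 / 2 * inner ℝ (∇ f (pos f ell x0 k) + ∇ f (pos f ell x0 (k + 1))) v ≤
          H / 4 * (‖v‖ ^ 2 * ‖v‖ ^ ν) := by
        rw [pos_succ]
        exact trapezoid_error_le hf hg hν hH0 hH (pos f ell x0 k) v
      have h2 : ‖v‖ ^ ν ≤ (((k + 1 : ℕ) : ℝ) * S) ^ (ν / 2) := by
        have : ‖v‖ ^ ν = (‖v‖ ^ 2) ^ (ν / 2) := by
          rw [← Real.rpow_natCast, ← Real.rpow_mul (norm_nonneg _)]
          congr 1
          push_cast
          ring
        rw [this]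
        refine Real.rpow_le_rpow (by positivity) ?_ (by linarith)
        exact (sq_norm_vel_le_sqSum f ell x0 (Nat.le_add_left 1 k) le_rfl).trans
          (le_mul_of_one_le_left hS0 hk1)
      have hR : 0 ≤ H * (((k + 1 : ℕ) : ℝ) * S) ^ (ν / 2) := by positivity
      rcases eq_or_ne v 0 with h0 | h0
      · rw [← hv, h0]
        simpa using hR
      have hv0 : 0 < ‖v‖ ^ 2 := by positivity
      rw [div_mul_eq_mul_div, div_le_iff₀ hv0]
      have h3 : H * ‖v‖ ^ ν ≤ H * (((k + 1 : ℕ) : ℝ) * S) ^ (ν / 2) := by gcongr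
      have h4 := mul_le_mul_of_nonneg_right h3 hv0.le
      have h5 := mul_nonneg hR hv0.le
      linarith
    · have hR : 0 ≤ H * (((k + 1 : ℕ) : ℝ) * S) ^ (ν / 2) := by positivity
      rcases hS0.eq_or_lt with h0 | h0
      · rw [← hSdef, ← h0]
        rw [← h0] at hR
        simpa using hR
      have hm := norm_gradient_mean_sub_le hg hν hν1 hH0 hH (pos f ell x0) (Nat.succ_pos k)
        (avg f ell x0 (k + 1)) rfl
      have hdev := mean_sq_deviation_le (pos f ell x0) (vel f ell x0) (pos_succ f ell x0)
        (Nat.succ_pos k) (avg f ell x0 (k + 1)) rfl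
      change _ ≤ ((k + 1 : ℕ) : ℝ) * S / 8 at hdev
      set W := ((k + 1 : ℕ) : ℝ) * S / 8 with hW
      have hW0 : 0 < W := by positivity
      have h1 : ‖∇ f (avg f ell x0 (k + 1))‖ - ell / ((k + 1 : ℕ) : ℝ) * ‖v‖ ≤
          H * W ^ ((1 + ν) / 2) := by
        refine le_trans ?_ (hm.trans (mul_le_mul_of_nonneg_left
          (Real.rpow_le_rpow (by positivity) hdev (by linarith)) hH0))
        have e : ‖(1 / ((k + 1 : ℕ) : ℝ)) • ∑ i ∈ Finset.range (k + 1), ∇ f (pos f ell x0 i)‖ =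
            ell / ((k + 1 : ℕ) : ℝ) * ‖v‖ := by
          rw [sum_gradient_pos f x0 hell, norm_smul, norm_neg, norm_smul,
            Real.norm_of_nonneg hell.le, Real.norm_of_nonneg (by positivity)]
          ring
        rw [← e]
        exact norm_sub_norm_le _ _
      rw [← inv_div, Real.sqrt_inv, inv_mul_le_iff₀ (Real.sqrt_pos.2 hW0)]
      refine h1.trans ?_
      have h2 : W ^ ((1 + ν) / 2) = √W * W ^ (ν / 2) := by
        rw [Real.sqrt_eq_rpow, ← Real.rpow_add hW0]
        congr 1
        ring
      have h3 : W ^ (ν / 2) ≤ (((k + 1 : ℕ) : ℝ) * S) ^ (ν / 2) := by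
        refine Real.rpow_le_rpow hW0.le ?_ (by linarith)
        have : 0 ≤ ((k + 1 : ℕ) : ℝ) * S := by positivity
        rw [hW]
        linarith
      calc H * W ^ ((1 + ν) / 2) = √W * (H * W ^ (ν / 2)) := by rw [h2]; ring
        _ ≤ _ := by gcongr

end Epoch

/-! ### Decrease of the objective within an epoch -/

section Decrease

variable {d : ℕ} {f : EuclideanSpace ℝ (Fin d) → ℝ} {ell : ℝ} {x0 : EuclideanSpace ℝ (Fin d)}

/-- Summed trapezoidal bounds: since `∇f(x_k) = ℓ (v_k - v_{k+1})`, the inner products telescope. -/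
theorem pos_sub_le (hell : 0 < ell) (k : ℕ) :
    f (pos f ell x0 k) - f x0 ≤
      -(ell / 2 * inner ℝ (vel f ell x0 k) (vel f ell x0 (k + 1))) +
        holderEst f ell x0 k / 3 * sqSum f ell x0 k := by
  induction k with
  | zero => simp
  | succ k ih =>
    have h := sub_le_of_holderEst f ell x0 k
    rw [gradient_pos f x0 hell k, gradient_pos f x0 hell (k + 1), ← smul_add, sub_add_sub_cancel,
      real_inner_smul_left, inner_sub_left,
      real_inner_comm (vel f ell x0 (k + 1)) (vel f ell x0 (k + 1 + 1))] at h
    have hm : holderEst f ell x0 k * sqSum f ell x0 k ≤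
        holderEst f ell x0 (k + 1) * sqSum f ell x0 k :=
      mul_le_mul_of_nonneg_right (holderEst_mono f ell x0 (Nat.le_succ k)) (sqSum_nonneg f ell x0 k)
    rw [sqSum_succ]
    linarith

/-- The descent condition at iteration `k + 1` and twice the telescoped bound at iteration `k` add up
to a decrease at one of the two points: the cross terms `⟨v_k, v_{k+1}⟩` cancel. -/
theorem le_decrease_of_descent (hell : 0 < ell) {k : ℕ} (hd : Descent f ell x0 (k + 1))
    {y : EuclideanSpace ℝ (Fin d)} (hy0 : f y ≤ f (pos f ell x0 k))
    (hy1 : f y ≤ f (pos f ell x0 (k + 1))) :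
    ell / 4 * ‖vel f ell x0 (k + 1)‖ ^ 2 - holderEst f ell x0 k / 3 * sqSum f ell x0 k ≤
      f x0 - f y := by
  have h1 := pos_sub_le (f := f) (x0 := x0) hell k
  rw [Descent, Nat.add_sub_cancel, gradient_pos f x0 hell k, real_inner_smul_left, inner_sub_left,
    real_inner_self_eq_norm_sq] at hd
  linarith

/-- If the second restart condition was not active before the last iteration, the decrease over an
epoch dominates the mean squared velocity. -/
theorem sqSum_le_decrease (hell : 0 < ell) {m : ℕ} (hd : ∀ j, 1 ≤ j → j ≤ m + 1 → Descent f ell x0 j)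
    (hl : ¬ LargeK f ell x0 m) {y : EuclideanSpace ℝ (Fin d)}
    (hy : ∀ j ≤ m + 1, f y ≤ f (pos f ell x0 j)) :
    3 / 16 * ell * sqSum f ell x0 (m + 1) ≤ (m + 1 : ℝ) * (f x0 - f y) := by
  rw [LargeK, gt_iff_lt, not_lt] at hl
  set h := holderEst f ell x0
  set S := sqSum f ell x0
  have hsum : ∑ j ∈ Finset.range (m + 1), (ell / 4 * ‖vel f ell x0 (j + 1)‖ ^ 2 - h j / 3 * S j) ≤
      ∑ j ∈ Finset.range (m + 1), (f x0 - f y) := by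
    refine Finset.sum_le_sum fun j hj => ?_
    rw [Finset.mem_range] at hj
    exact le_decrease_of_descent hell (hd (j + 1) (by omega) (by omega)) (hy j (by omega))
      (hy (j + 1) (by omega))
  have hS : ∑ j ∈ Finset.range (m + 1), ‖vel f ell x0 (j + 1)‖ ^ 2 = S (m + 1) := by
    rw [Finset.range_eq_Ico, Finset.sum_Ico_add' (fun j => ‖vel f ell x0 j‖ ^ 2) 0 (m + 1) 1]
    rfl
  have hh : ∑ j ∈ Finset.range (m + 1), h j / 3 * S j ≤ m * (h m / 3 * S (m + 1)) := by
    rw [Finset.sum_range_succ']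
    have h0 : h 0 = 0 := rfl
    rw [h0, zero_div, zero_mul, add_zero, ← nsmul_eq_mul]
    refine (Finset.sum_le_card_nsmul _ _ (h m / 3 * S (m + 1)) fun j hj => ?_).trans_eq
      (by rw [Finset.card_range])
    rw [Finset.mem_range] at hj
    have hjm : h (j + 1) ≤ h m := holderEst_mono f ell x0 (by omega)
    have hSm : S (j + 1) ≤ S (m + 1) := sqSum_mono f ell x0 (by omega)
    have := sqSum_nonneg f ell x0 (j + 1)
    have := holderEst_nonneg f ell x0 m
    gcongr
  have hmh : m * h m ≤ 3 / 16 * ell := by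
    rcases Nat.eq_zero_or_pos m with h0 | h0
    · rw [h0, Nat.cast_zero, zero_mul]; positivity
    · have h1 : (1 : ℝ) ≤ m := by exact_mod_cast h0
      have h2 : 0 ≤ m * h m := mul_nonneg (by positivity) (holderEst_nonneg f ell x0 m)
      nlinarith
  rw [Finset.sum_sub_distrib, ← Finset.mul_sum, hS, Finset.sum_const, Finset.card_range,
    nsmul_eq_mul] at hsum
  push_cast at hsum
  have := mul_le_mul_of_nonneg_right hmh (sqSum_nonneg f ell x0 (m + 1))
  linarith

theorem norm_gradient_eq_vel_one (hell : 0 < ell) : ‖∇ f x0‖ = ell * ‖vel f ell x0 1‖ := by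
  have h := gradient_pos f x0 hell 0
  rw [pos_zero, vel_zero, zero_sub] at h
  rw [h, norm_smul, norm_neg, Real.norm_of_nonneg hell.le]

theorem cube_div_three_le_sum_sq (m : ℕ) :
    (m : ℝ) ^ 3 / 3 ≤ ∑ j ∈ Finset.Icc 1 m, (j : ℝ) ^ 2 := by
  induction m with
  | zero => simp
  | succ m ih =>
    rw [Finset.sum_Icc_succ_top (by omega)]
    push_cast
    have : (0 : ℝ) ≤ m := by positivity
    nlinarith

/-- As long as the gradients at the averages are large and no restart takes place, the velocities
are large. -/
theorem le_sqSum_of_lt_norm_gradient (hell : 0 < ell) {ε : ℝ} (hε : 0 < ε) {m : ℕ} (hm : 1 ≤ m)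
    (hu : ∀ j, 1 ≤ j → j ≤ m → ε < ‖∇ f (avg f ell x0 j)‖) (hl : ¬ LargeK f ell x0 m) :
    (m : ℝ) ^ 3 * ε ^ 2 ≤ 4 * ell ^ 2 * sqSum f ell x0 m := by
  rw [LargeK, gt_iff_lt, not_lt] at hl
  set h := holderEst f ell x0 m with hh
  have hh0 : 0 ≤ h := holderEst_nonneg f ell x0 m
  set S := sqSum f ell x0 m with hS
  have hS0 : 0 ≤ S := sqSum_nonneg f ell x0 m
  have hm0 : (1 : ℝ) ≤ m := by exact_mod_cast hm
  have hv1 : 0 < ‖vel f ell x0 1‖ := by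
    have h1 := hu 1 le_rfl hm
    rw [avg_one, norm_gradient_eq_vel_one hell] at h1
    exact pos_of_mul_pos_right (hε.trans h1) hell.le
  set r := √(m * S / 8) with hr
  have hr2 : r ^ 2 = m * S / 8 := Real.sq_sqrt (by positivity)
  have hr0 : 0 ≤ r := Real.sqrt_nonneg _
  -- `w ^ 2` is the scale `ℓ² S / m³` against which `ε ^ 2` is measured
  set w := √(ell ^ 2 * S / m ^ 3) with hw
  have hw2 : w ^ 2 = ell ^ 2 * S / m ^ 3 := Real.sq_sqrt (by positivity)
  have hw0 : 0 ≤ w := Real.sqrt_nonneg _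
  have hgrad : ∀ j, 1 ≤ j → j ≤ m → j * (ε - h * r) ≤ ell * ‖vel f ell x0 j‖ := by
    intro j hj hjm
    obtain ⟨i, rfl⟩ := Nat.exists_eq_add_of_le' hj
    have hSi : 0 < sqSum f ell x0 (i + 1) :=
      (by positivity : 0 < ‖vel f ell x0 1‖ ^ 2).trans_le
        (sq_norm_vel_le_sqSum f ell x0 le_rfl hj)
    have h1 := (hu _ hj hjm).le.trans (norm_gradient_avg_le_of_holderEst f ell x0 hSi)
    have hj0 : (0 : ℝ) < ((i + 1 : ℕ) : ℝ) := by positivity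
    have h2 : holderEst f ell x0 (i + 1) *
        √(((i + 1 : ℕ) : ℝ) * sqSum f ell x0 (i + 1) / 8) ≤ h * r := by
      have a1 : holderEst f ell x0 (i + 1) ≤ h := holderEst_mono f ell x0 hjm
      have a2 : ((i + 1 : ℕ) : ℝ) ≤ m := by exact_mod_cast hjm
      have a3 : sqSum f ell x0 (i + 1) ≤ S := sqSum_mono f ell x0 hjm
      rw [hr]
      gcongr
    have h3 : ε - h * r ≤ ell / ((i + 1 : ℕ) : ℝ) * ‖vel f ell x0 (i + 1)‖ := by linarith
    rwa [div_mul_eq_mul_div, le_div_iff₀ hj0, mul_comm] at h3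
  -- the contribution of the estimate `h` is negligible: `3 / (8 √8) < 1 / 5`
  have hhr : h * r ≤ 1 / 5 * w := by
    refine abs_le_of_sq_le_sq' ?_ (by positivity) |>.2
    have h1 : h ≤ 3 / 8 * ell / m ^ 2 := by
      rw [le_div_iff₀ (by positivity)]
      nlinarith
    calc (h * r) ^ 2 = h ^ 2 * (m * S / 8) := by rw [mul_pow, hr2]
      _ ≤ (3 / 8 * ell / m ^ 2) ^ 2 * (m * S / 8) := by gcongr
      _ = 9 / 512 * w ^ 2 := by rw [hw2]; field_simp; ring
      _ ≤ (1 / 5 * w) ^ 2 := by nlinarith [sq_nonneg w]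
  have hη : ε - h * r ≤ 9 / 5 * w := by
    rcases le_total (ε - h * r) 0 with h0 | h0
    · exact h0.trans (by positivity)
    refine abs_le_of_sq_le_sq' ?_ (by positivity) |>.2
    have h1 : ∑ j ∈ Finset.Icc 1 m, (j : ℝ) ^ 2 * (ε - h * r) ^ 2 ≤
        ∑ j ∈ Finset.Icc 1 m, ell ^ 2 * ‖vel f ell x0 j‖ ^ 2 := by
      refine Finset.sum_le_sum fun j hj => ?_
      rw [Finset.mem_Icc] at hj
      rw [← mul_pow, ← mul_pow]
      exact pow_le_pow_left₀ (by positivity) (hgrad j hj.1 hj.2) 2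
    rw [← Finset.sum_mul, ← Finset.mul_sum] at h1
    have h2 : (m : ℝ) ^ 3 / 3 * (ε - h * r) ^ 2 ≤ ell ^ 2 * S :=
      (mul_le_mul_of_nonneg_right (cube_div_three_le_sum_sq m) (sq_nonneg _)).trans h1
    have h3 : (ε - h * r) ^ 2 ≤ 3 * w ^ 2 := by
      rw [hw2, mul_div_assoc', le_div_iff₀ (by positivity)]
      linarith
    nlinarith [sq_nonneg w]
  have hfin : ε ^ 2 ≤ (2 * w) ^ 2 := pow_le_pow_left₀ hε.le (by linarith) 2
  rw [mul_pow, hw2, mul_div_assoc', le_div_iff₀ (by positivity)] at hfin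
  linarith

/-- The iterations `1, …, k` of the epoch triggered no restart, and the gradients at their averages
are larger than `ε`. -/
def Unfinished (f : EuclideanSpace ℝ (Fin d) → ℝ) (ell : ℝ) (x0 : EuclideanSpace ℝ (Fin d)) (ε : ℝ)
    (k : ℕ) : Prop :=
  ∀ j, 1 ≤ j → j ≤ k →
    Descent f ell x0 j ∧ ¬ LargeK f ell x0 j ∧ ε < ‖∇ f (avg f ell x0 j)‖

theorem not_largeK_zero (hell : 0 < ell) : ¬ LargeK f ell x0 0 := by
  simp only [LargeK, gt_iff_lt, not_lt, Nat.cast_zero, zero_mul]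
  positivity

theorem Unfinished.not_largeK (hell : 0 < ell) {ε : ℝ} {m : ℕ} (h : Unfinished f ell x0 ε m) :
    ¬ LargeK f ell x0 m := by
  rcases Nat.eq_zero_or_pos m with rfl | h0
  · exact not_largeK_zero hell
  · exact (h m h0 le_rfl).2.1

/-- The decrease after `m` iterations without a restart is at least of the order `m² ε² / ℓ`. -/
theorem Unfinished.sq_le_decrease (hell : 0 < ell) {ε : ℝ} (hε : 0 < ε) {m : ℕ}
    (h : Unfinished f ell x0 ε m) {y : EuclideanSpace ℝ (Fin d)}
    (hy : ∀ j ≤ m, f y ≤ f (pos f ell x0 j)) :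
    (m : ℝ) ^ 2 * ε ^ 2 ≤ 64 / 3 * ell * (f x0 - f y) := by
  rcases Nat.eq_zero_or_pos m with rfl | h0
  · have := hy 0 le_rfl
    rw [pos_zero] at this
    have : 0 ≤ f x0 - f y := sub_nonneg.2 this
    simpa using mul_nonneg (by positivity : 0 ≤ 64 / 3 * ell) this
  have h1 := le_sqSum_of_lt_norm_gradient hell hε h0 (fun j hj hjm => (h j hj hjm).2.2)
    (h m h0 le_rfl).2.1
  obtain ⟨n, rfl⟩ := Nat.exists_eq_add_of_le' h0
  have hl : ¬ LargeK f ell x0 n :=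
    Unfinished.not_largeK hell (fun j hj hjn => h j hj (by omega))
  have h2 := sqSum_le_decrease hell (fun j hj hjm => (h j hj hjm).1) hl hy
  push_cast at h1 ⊢
  have hn : (0 : ℝ) < n + 1 := by positivity
  have h3 : ((n : ℝ) + 1) * (((n : ℝ) + 1) ^ 2 * ε ^ 2) ≤
      (n + 1) * (64 / 3 * ell * (f x0 - f y)) := by
    nlinarith
  exact le_of_mul_le_mul_left h3 hn

/-- The decrease over a successful epoch, which ends at iteration `m + 1`. -/
theorem Unfinished.sq_succ_le_decrease (hell : 0 < ell) {ε : ℝ} (hε : 0 < ε) {m : ℕ}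
    (h : Unfinished f ell x0 ε m) (hd : Descent f ell x0 (m + 1))
    (hu : ε < ‖∇ f (avg f ell x0 (m + 1))‖) {y : EuclideanSpace ℝ (Fin d)}
    (hy : ∀ j ≤ m + 1, f y ≤ f (pos f ell x0 j)) :
    ((m : ℝ) + 1) ^ 2 * ε ^ 2 ≤ 38 * ell * (f x0 - f y) := by
  have hD : 0 ≤ f x0 - f y := sub_nonneg.2 (hy 0 (Nat.zero_le _))
  have hlD : 0 ≤ ell * (f x0 - f y) := by positivity
  rcases le_or_gt 3 m with h3 | h3
  -- for `m ≥ 3`, `(m + 1)² ≤ (16 / 9) m²`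
  · have h1 := h.sq_le_decrease hell hε (y := y) (fun j hj => hy j (by omega))
    have h3' : (3 : ℝ) ≤ m := by exact_mod_cast h3
    have h4 : ((m : ℝ) + 1) ^ 2 ≤ 16 / 9 * m ^ 2 := by nlinarith
    have h5 := mul_le_mul_of_nonneg_right h4 (sq_nonneg ε)
    linarith
  -- for `m ≤ 2`, the first iteration decreases the objective enough
  · have hd1 : Descent f ell x0 1 := by
      rcases Nat.eq_zero_or_pos m with rfl | h0
      · exact hd
      · exact (h 1 le_rfl h0).1
    have hu1 : ε < ‖∇ f (avg f ell x0 1)‖ := by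
      rcases Nat.eq_zero_or_pos m with rfl | h0
      · exact hu
      · exact (h 1 le_rfl h0).2.2
    have h1 := le_decrease_of_descent hell (k := 0) hd1 (hy 0 (Nat.zero_le _)) (hy 1 (by omega))
    rw [holderEst_zero, zero_div, zero_mul, sub_zero, zero_add] at h1
    rw [avg_one, norm_gradient_eq_vel_one hell] at hu1
    have h2 := pow_le_pow_left₀ hε.le hu1.le 2
    have h3' : (m : ℝ) ≤ 2 := by exact_mod_cast (by omega : m ≤ 2)
    have h4 : ((m : ℝ) + 1) ^ 2 ≤ 9 := by nlinarith [(Nat.cast_nonneg m : (0 : ℝ) ≤ m)]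
    have h5 := mul_le_mul_of_nonneg_right h4 (sq_nonneg ε)
    have h6 := mul_le_mul_of_nonneg_left h1 hell.le
    nlinarith

/-- The number `G = H^(1/(1+ν)) ε^(-(2+ν)/(1+ν))`: its product with the decrease of the objective
bounds, up to a constant, the number of successful epochs. -/
noncomputable def epochRate (H ν ε : ℝ) : ℝ := H ^ (1 / (1 + ν)) * ε ^ (-((2 + ν) / (1 + ν)))

theorem epochRate_nonneg {H ν ε : ℝ} (hH : 0 ≤ H) (hε : 0 < ε) : 0 ≤ epochRate H ν ε := by
  unfold epochRate; positivity

/-- Elimination of the length scale `r` and of `X = ℓ / k²` from the three inequalities that hold at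
the end of a successful epoch. -/
theorem one_le_mul_epochRate {P X r2 ε H ν : ℝ} (hν : 0 ≤ ν) (hε : 0 < ε) (hX : 0 < X)
    (hr : 0 ≤ r2) (hH0 : 0 ≤ H) (h1 : ε ^ 2 ≤ P * X) (h2 : X * r2 ≤ P)
    (h3 : 3 / 16 * X ≤ H * r2 ^ (ν / 2)) :
    1 ≤ 16 / 3 * P * epochRate H ν ε := by
  have hP : 0 < P := pos_of_mul_pos_left ((by positivity : 0 < ε ^ 2).trans_le h1) hX.le
  have hH : 0 < H := by
    rcases hH0.eq_or_lt with h | h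
    · rw [← h, zero_mul] at h3
      linarith
    · exact h
  have hε2 : ε ^ (2 + ν) = (ε ^ 2) ^ ((2 + ν) / 2) := by
    rw [← Real.rpow_natCast, ← Real.rpow_mul hε.le]
    congr 1
    push_cast
    ring
  -- `q ε^(2+ν) ≤ H P^(1+ν)` with `q = 3 / 16`
  have key : 3 / 16 * ε ^ (2 + ν) ≤ H * P ^ (1 + ν) := by
    have a1 : ε ^ (2 + ν) ≤ P ^ ((2 + ν) / 2) * X ^ ((2 + ν) / 2) := by
      rw [hε2, ← Real.mul_rpow hP.le hX.le]
      exact Real.rpow_le_rpow (by positivity) h1 (by linarith)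
    have a2 : X ^ (ν / 2) * r2 ^ (ν / 2) ≤ P ^ (ν / 2) := by
      rw [← Real.mul_rpow hX.le hr]
      exact Real.rpow_le_rpow (by positivity) h2 (by linarith)
    have a3 : X ^ ((2 + ν) / 2) = X * X ^ (ν / 2) := by
      rw [← Real.rpow_one_add' hX.le (by linarith)]
      congr 1
      ring
    have a4 : P ^ (1 + ν) = P ^ ((2 + ν) / 2) * P ^ (ν / 2) := by
      rw [← Real.rpow_add hP]
      congr 1
      ring
    calc 3 / 16 * ε ^ (2 + ν) ≤ 3 / 16 * (P ^ ((2 + ν) / 2) * X ^ ((2 + ν) / 2)) := by gcongr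
      _ = P ^ ((2 + ν) / 2) * ((3 / 16 * X) * X ^ (ν / 2)) := by rw [a3]; ring
      _ ≤ P ^ ((2 + ν) / 2) * ((H * r2 ^ (ν / 2)) * X ^ (ν / 2)) := by gcongr
      _ = H * (P ^ ((2 + ν) / 2) * (X ^ (ν / 2) * r2 ^ (ν / 2))) := by ring
      _ ≤ H * (P ^ ((2 + ν) / 2) * P ^ (ν / 2)) := by gcongr
      _ = H * P ^ (1 + ν) := by rw [a4]
  have hν1 : 0 < 1 + ν := by linarith
  have root := Real.rpow_le_rpow (by positivity) key (z := 1 / (1 + ν)) (by positivity)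
  rw [Real.mul_rpow (by norm_num) (by positivity), Real.mul_rpow hH0 (by positivity),
    ← Real.rpow_mul hε.le, ← Real.rpow_mul hP.le, mul_one_div_cancel hν1.ne', Real.rpow_one,
    mul_one_div] at root
  have hq : (3 / 16 : ℝ) ≤ (3 / 16) ^ (1 / (1 + ν)) := by
    conv_lhs => rw [← Real.rpow_one (3 / 16 : ℝ)]
    exact Real.rpow_le_rpow_of_exponent_ge (by norm_num) (by norm_num)
      ((div_le_one hν1).2 (by linarith))
  have hb : 0 < ε ^ ((2 + ν) / (1 + ν)) := by positivity
  have h4 : 3 / 16 * ε ^ ((2 + ν) / (1 + ν)) ≤ H ^ (1 / (1 + ν)) * P :=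
    (mul_le_mul_of_nonneg_right hq hb.le).trans root
  rw [epochRate, Real.rpow_neg hε.le]
  have e : 16 / 3 * P * (H ^ (1 / (1 + ν)) * (ε ^ ((2 + ν) / (1 + ν)))⁻¹) =
      16 / 3 * (H ^ (1 / (1 + ν)) * P) / ε ^ ((2 + ν) / (1 + ν)) := by
    rw [div_eq_mul_inv _ (ε ^ _)]; ring
  rw [e, le_div_iff₀ hb]
  linarith

/-- The decrease over a successful epoch is bounded below, independently of the epoch. -/
theorem Unfinished.one_le_decrease (hell : 0 < ell) {ε : ℝ} (hε : 0 < ε) {m : ℕ}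
    (hf : Differentiable ℝ f) (hg : Differentiable ℝ (∇ f))
    {H ν : ℝ} (hν : 0 ≤ ν) (hν1 : ν ≤ 1) (hH0 : 0 ≤ H) (hH : HolderHessian f H ν)
    (h : Unfinished f ell x0 ε m) (hd : Descent f ell x0 (m + 1)) (hl : LargeK f ell x0 (m + 1))
    (hu : ε < ‖∇ f (avg f ell x0 (m + 1))‖) {y : EuclideanSpace ℝ (Fin d)}
    (hy : ∀ j ≤ m + 1, f y ≤ f (pos f ell x0 j)) :
    1 ≤ 608 / 3 * epochRate H ν ε * (f x0 - f y) := by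
  have hD : 0 ≤ f x0 - f y := sub_nonneg.2 (hy 0 (Nat.zero_le _))
  have hk : (0 : ℝ) < m + 1 := by positivity
  have hk1 : (1 : ℝ) ≤ m + 1 := le_add_of_nonneg_left (by positivity)
  have h1 := h.sq_succ_le_decrease hell hε hd hu hy
  have h2 := sqSum_le_decrease hell
    (fun j hj hjm => (Nat.lt_or_ge j (m + 1)).elim (fun hlt => (h j hj (by omega)).1)
      (fun hge => by rwa [le_antisymm hjm hge]))
    (h.not_largeK hell) hy
  have h3 := holderEst_le f x0 hf hg hν hν1 hH0 hH hell (m + 1)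
  rw [LargeK] at hl
  push_cast at hl h3
  set S := sqSum f ell x0 (m + 1)
  have hS0 : 0 ≤ S := sqSum_nonneg f ell x0 (m + 1)
  set D := f x0 - f y
  have := one_le_mul_epochRate (P := 38 * D) (X := ell / (m + 1) ^ 2) (r2 := (m + 1) * S) (H := H)
    hν hε (by positivity) (by positivity) hH0
    (by rw [mul_div_assoc', le_div_iff₀ (by positivity)]; linarith)
    (by
      have e : ell / ((m : ℝ) + 1) ^ 2 * ((m + 1) * S) = ell * S / (m + 1) := by field_simp
      rw [e, div_le_iff₀ hk]
      have := mul_nonneg hk.le hD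
      linarith)
    (by
      refine le_trans ?_ h3
      rw [mul_div_assoc', div_le_iff₀ (by positivity)]
      have h0 := holderEst_nonneg f ell x0 (m + 1)
      have := mul_nonneg (mul_nonneg hk.le (by linarith : (0 : ℝ) ≤ m)) h0
      nlinarith)
  linarith

/-- The length of a successful epoch in terms of the decrease. -/
theorem length_le_decrease {k ell ε D G : ℝ} (hell : 0 < ell) (hε : 0 < ε) (hD : 0 ≤ D)
    (hG : 0 ≤ G) (h1 : k ^ 2 * ε ^ 2 ≤ 38 * ell * D) (h2 : 1 ≤ 608 / 3 * G * D) :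
    k ≤ 88 * (√(ell * G) / ε) * D := by
  refine abs_le_of_sq_le_sq' ?_ (by positivity) |>.2
  have e : (88 * (√(ell * G) / ε) * D) ^ 2 = 7744 * (ell * G) * D ^ 2 / ε ^ 2 := by
    rw [mul_pow, mul_pow, div_pow, Real.sq_sqrt (by positivity)]; ring
  rw [e, le_div_iff₀ (by positivity)]
  have h3 : 0 ≤ ell * D := by positivity
  have h4 := mul_le_mul_of_nonneg_left h2 h3
  have h5 : 0 ≤ ell * G * D ^ 2 := by positivity
  nlinarith

end Decrease

/-! ### Accounting over the epochs of a run -/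

section Run

variable {d : ℕ} {f : EuclideanSpace ℝ (Fin d) → ℝ}

theorem sub_le_of_lipschitz_gradient {E : Type*} [NormedAddCommGroup E] [InnerProductSpace ℝ E]
    [CompleteSpace E] {f : E → ℝ} (hf : Differentiable ℝ f) {L : ℝ}
    (hL : ∀ x y, ‖∇ f x - ∇ f y‖ ≤ L * ‖x - y‖) (x v : E) :
    f (x + v) - f x ≤ inner ℝ (∇ f x) v + L / 2 * ‖v‖ ^ 2 := by
  set φ : ℝ → ℝ := fun t => f (x + t • v) with hφ
  set g : ℝ → ℝ := fun t => L / 2 * ‖v‖ ^ 2 * t ^ 2 - (φ t - inner ℝ (∇ f x) v * t) with hgdef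
  have dg : ∀ t, HasDerivAt g
      (L * ‖v‖ ^ 2 * t - (inner ℝ (∇ f (x + t • v)) v - inner ℝ (∇ f x) v)) t := by
    intro t
    have h1 : HasDerivAt (fun t : ℝ => L / 2 * ‖v‖ ^ 2 * t ^ 2) (L * ‖v‖ ^ 2 * t) t := by
      refine ((hasDerivAt_pow 2 t).const_mul (L / 2 * ‖v‖ ^ 2)).congr_deriv ?_
      norm_num
      ring
    have h2 : HasDerivAt (fun t : ℝ => inner ℝ (∇ f x) v * t) (inner ℝ (∇ f x) v) t := by
      simpa using (hasDerivAt_id t).const_mul (inner ℝ (∇ f x) v)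
    exact h1.sub ((hasDerivAt_comp_line hf x v t).sub h2)
  have mono : MonotoneOn g (Set.Icc 0 1) := by
    refine monotoneOn_of_deriv_nonneg (convex_Icc 0 1)
      (fun t _ => (dg t).continuousAt.continuousWithinAt)
      (fun t _ => (dg t).differentiableAt.differentiableWithinAt) ?_
    intro t ht
    rw [interior_Icc] at ht
    rw [(dg t).deriv, ← inner_sub_left]
    have h1 := hL (x + t • v) x
    rw [add_sub_cancel_left, norm_smul, Real.norm_of_nonneg ht.1.le] at h1
    have h2 := (real_inner_le_norm (∇ f (x + t • v) - ∇ f x) v).trans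
      (mul_le_mul_of_nonneg_right h1 (norm_nonneg v))
    linarith
  have h01 := mono (Set.left_mem_Icc.2 zero_le_one) (Set.right_mem_Icc.2 zero_le_one) zero_le_one
  simp only [hgdef, hφ, zero_smul, add_zero, one_smul] at h01
  linarith

theorem descent_of_le (hf : Differentiable ℝ f) {L : ℝ}
    (hL : ∀ x y, ‖∇ f x - ∇ f y‖ ≤ L * ‖x - y‖) {ell : ℝ} (h : L ≤ ell)
    (x0 : EuclideanSpace ℝ (Fin d)) (k : ℕ) : Descent f ell x0 (k + 1) := by
  rw [Descent, Nat.add_sub_cancel, pos_succ]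
  refine (sub_le_of_lipschitz_gradient hf hL _ _).trans ?_
  gcongr

theorem IsBest.le_pos {ell : ℝ} {x0 y : EuclideanSpace ℝ (Fin d)} {k : ℕ}
    (h : IsBest f ell x0 k y) : ∀ j ≤ k, f y ≤ f (pos f ell x0 j) :=
  fun j hj => h.2 _ (Or.inl ⟨j, hj, rfl⟩)

/-- Cauchy–Schwarz, one summand at a time: if `M` is a sum of `n` numbers with sum of squares `Q`,
the inequality `M² ≤ n Q` survives the addition of another number. -/
theorem sq_add_le_succ_mul {M Q n m : ℝ} (hn : 0 ≤ n) (hQ : 0 ≤ Q) (h : M ^ 2 ≤ n * Q) :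
    (M + m) ^ 2 ≤ (n + 1) * (Q + m ^ 2) := by
  have h1 : 2 * M * m ≤ Q + n * m ^ 2 := by
    refine abs_le_of_sq_le_sq' ?_ (by positivity) |>.2
    nlinarith [sq_nonneg (Q - n * m ^ 2), mul_le_mul_of_nonneg_right h (sq_nonneg m)]
  linarith

/-- The accounts of a run after `J` passes, in the state `σ`. There have been `n` unsuccessful and
`N` successful epochs. The successful ones took `A` iterations; the unsuccessful ones took `M`
iterations beside the last of each, and `Q` is the sum of the squares of the corresponding lengths.
The bounds on `A`, `N` and `Q` are multiples of the decrease of the objective so far. -/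
structure Ledger (f : EuclideanSpace ℝ (Fin d) → ℝ) (xInit : EuclideanSpace ℝ (Fin d))
    (ellInit α β lmax ε G : ℝ) (J : ℕ) (σ : State d) (n N : ℕ) (A M Q : ℝ) : Prop where
  count : (J : ℝ) = A + M + n + σ.k
  ell_eq : σ.ell = ellInit * α ^ n * β ^ N
  ell_le : σ.ell ≤ lmax
  nonneg : 0 ≤ Q
  sq_le : M ^ 2 ≤ n * Q
  successful_le : A ≤ 88 * (√(lmax * G) / ε) * (f xInit - f σ.x0)
  number_le : N ≤ 608 / 3 * G * (f xInit - f σ.x0)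
  squares_le : Q * ε ^ 2 ≤ 64 / 3 * lmax * (f xInit - f σ.x0)
  unfinished : Unfinished f σ.ell σ.x0 ε σ.k

theorem unfinished_zero (ell : ℝ) (x0 : EuclideanSpace ℝ (Fin d)) (ε : ℝ) :
    Unfinished f ell x0 ε 0 :=
  fun j hj hj0 => by omega

theorem Ledger.step {xInit : EuclideanSpace ℝ (Fin d)} {ellInit α β lmax ε G L H ν : ℝ}
    (hf : Differentiable ℝ f) (hg : Differentiable ℝ (∇ f))
    (hLip : ∀ x y, ‖∇ f x - ∇ f y‖ ≤ L * ‖x - y‖)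
    (hinit : 0 < ellInit) (hα : 1 < α) (hβ0 : 0 < β) (hβ1 : β ≤ 1) (hmax : α * L ≤ lmax)
    (hε : 0 < ε) (hν : 0 ≤ ν) (hν1 : ν ≤ 1) (hH0 : 0 ≤ H) (hH : HolderHessian f H ν)
    (hGdef : G = epochRate H ν ε) {J : ℕ} {σ τ : State d} {n N : ℕ} {A M Q : ℝ}
    (h : Ledger f xInit ellInit α β lmax ε G J σ n N A M Q) (hstep : Step f α β σ τ)
    (hu : ε < ‖∇ f (avg f σ.ell σ.x0 (σ.k + 1))‖) :
    ∃ (n N : ℕ) (A M Q : ℝ), Ledger f xInit ellInit α β lmax ε G (J + 1) τ n N A M Q := by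
  have hα0 : 0 < α := by linarith
  have hell : 0 < σ.ell := by rw [h.ell_eq]; positivity
  have hlmax : 0 < lmax := hell.trans_le h.ell_le
  have hG : 0 ≤ G := hGdef ▸ epochRate_nonneg hH0 hε
  have hA0 : 0 ≤ 88 * (√(lmax * G) / ε) := by positivity
  cases hstep with
  | unsuccessful y hy hd =>
    have hys : ∀ j ≤ σ.k, f y ≤ f (pos f σ.ell σ.x0 j) := fun j hj => hy.le_pos j (by omega)
    have hD : 0 ≤ f σ.x0 - f y := sub_nonneg.2 (hys 0 (Nat.zero_le _))
    have hlt : σ.ell < L := by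
      by_contra hc
      exact hd (descent_of_le hf hLip (not_lt.1 hc) σ.x0 σ.k)
    have hsq := h.unfinished.sq_le_decrease hell hε hys
    refine ⟨n + 1, N, A, M + σ.k, Q + (σ.k : ℝ) ^ 2, ?_⟩
    constructor
    · have := h.count
      push_cast
      linarith
    · change α * σ.ell = _
      rw [h.ell_eq]
      ring
    · change α * σ.ell ≤ _
      exact (mul_le_mul_of_nonneg_left hlt.le hα0.le).trans hmax
    · have := h.nonneg
      positivity
    · push_cast
      exact sq_add_le_succ_mul (by positivity) h.nonneg h.sq_le
    · refine h.successful_le.trans (mul_le_mul_of_nonneg_left ?_ hA0)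
      change _ ≤ f xInit - f y
      linarith
    · refine h.number_le.trans (mul_le_mul_of_nonneg_left ?_ (by positivity))
      change _ ≤ f xInit - f y
      linarith
    · change _ ≤ 64 / 3 * lmax * (f xInit - f y)
      have h1 := h.squares_le
      have h2 := mul_le_mul_of_nonneg_right h.ell_le hD
      linarith
    · exact unfinished_zero _ _ _
  | successful y hy hd hl =>
    have hys := hy.le_pos
    have hD : 0 ≤ f σ.x0 - f y := sub_nonneg.2 (hys 0 (Nat.zero_le _))
    have hsq := h.unfinished.sq_succ_le_decrease hell hε hd hu hys
    have hone := h.unfinished.one_le_decrease hell hε hf hg hν hν1 hH0 hH hd hl hu hys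
    rw [← hGdef] at hone
    have hlen := length_le_decrease hlmax hε hD hG
      (hsq.trans (by have := h.ell_le; gcongr)) hone
    refine ⟨n, N + 1, A + (σ.k + 1), M, Q, ?_⟩
    constructor
    · have := h.count
      push_cast
      linarith
    · change β * σ.ell = _
      rw [h.ell_eq]
      ring
    · change β * σ.ell ≤ _
      exact (mul_le_of_le_one_left hell.le hβ1).trans h.ell_le
    · exact h.nonneg
    · exact h.sq_le
    · change _ ≤ _ * (f xInit - f y)
      have := h.successful_le
      linarith
    · change _ ≤ _ * (f xInit - f y)
      have := h.number_le
      push_cast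
      linarith
    · refine h.squares_le.trans (mul_le_mul_of_nonneg_left ?_ (by positivity))
      change _ ≤ f xInit - f y
      linarith
    · exact unfinished_zero _ _ _
  | proceed hd hl =>
    refine ⟨n, N, A, M, Q, ?_, h.ell_eq, h.ell_le, h.nonneg, h.sq_le, h.successful_le,
      h.number_le, h.squares_le, ?_⟩
    · have := h.count
      push_cast
      linarith
    · intro j hj hjk
      rcases Nat.lt_or_ge j (σ.k + 1) with hlt | hge
      · exact h.unfinished j hj (by omega)
      · obtain rfl : j = σ.k + 1 := le_antisymm hjk hge
        exact ⟨hd, hl, hu⟩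

/-- The number of unsuccessful epochs is bounded through the growth of the Lipschitz estimate. -/
theorem succ_le_of_mul_pow_le {ellInit α β L : ℝ} (hinit : 0 < ellInit) (hα : 1 < α) (hβ0 : 0 < β)
    {n N : ℕ} (h : ellInit * α ^ n * β ^ N ≤ ellBar ellInit α L) :
    (n : ℝ) + 1 ≤ c₂ ellInit α L + c₁ α β * N := by
  have hα0 : 0 < α := by linarith
  have h1 : α ^ n * β ^ N ≤ ellBar ellInit α L / ellInit := by
    rw [le_div_iff₀ hinit]
    linarith
  have h2 := Real.logb_le_logb_of_le hα (by positivity) h1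
  rw [Real.logb_mul (by positivity) (by positivity), Real.logb_pow, Real.logb_pow,
    Real.logb_self_eq_one hα] at h2
  rw [c₂, c₁, one_div, Real.logb_inv]
  linarith

theorem c₁_nonneg {α β : ℝ} (hα : 1 < α) (hβ0 : 0 < β) (hβ1 : β ≤ 1) : 0 ≤ c₁ α β :=
  Real.logb_nonneg hα ((one_le_div hβ0).2 hβ1)

theorem ellBar_pos {ellInit α L : ℝ} (hinit : 0 < ellInit) : 0 < ellBar ellInit α L :=
  hinit.trans_le (le_max_left _ _)

theorem one_le_c₂ {ellInit α L : ℝ} (hinit : 0 < ellInit) (hα : 1 < α) : 1 ≤ c₂ ellInit α L :=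
  le_add_of_nonneg_right
    (Real.logb_nonneg hα ((one_le_div hinit).2 (le_max_left _ _)))

theorem gap_nonneg (hbdd : BddBelow (Set.range f)) (x : EuclideanSpace ℝ (Fin d)) : 0 ≤ gap f x :=
  sub_nonneg.2 (ciInf_le hbdd x)

/-- The complexity bound in terms of the rate `G`. -/
noncomputable def iterationBound (ellInit α β L Δ ε G : ℝ) : ℝ :=
  91 * (1 + √(c₁ α β)) * Δ * √(ellBar ellInit α L) * (√G / ε) + 256 * c₁ α β * Δ * G +
    (6 * √(c₂ ellInit α L * Δ * ellBar ellInit α L) * ε⁻¹ + c₂ ellInit α L)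

theorem Ledger.succ_le_iterationBound {xInit : EuclideanSpace ℝ (Fin d)} {ellInit α β L ε G : ℝ}
    (hbdd : BddBelow (Set.range f)) (hinit : 0 < ellInit) (hα : 1 < α) (hβ0 : 0 < β) (hβ1 : β ≤ 1)
    (hε : 0 < ε) (hG : 0 ≤ G) {J : ℕ} {σ : State d} {n N : ℕ} {A M Q : ℝ}
    (h : Ledger f xInit ellInit α β (ellBar ellInit α L) ε G J σ n N A M Q) :
    (J : ℝ) + 1 ≤ iterationBound ellInit α β L (gap f xInit) ε G := by
  have hα0 : 0 < α := by linarith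
  have hell : 0 < σ.ell := by rw [h.ell_eq]; positivity
  have hc₁ := c₁_nonneg hα hβ0 hβ1
  have hc₂ := one_le_c₂ (L := L) hinit hα
  have hΔ := gap_nonneg hbdd xInit
  have hlmax : 0 < ellBar ellInit α L := ellBar_pos hinit
  have hn : (n : ℝ) + 1 ≤ c₂ ellInit α L + c₁ α β * N :=
    succ_le_of_mul_pow_le hinit hα hβ0 (h.ell_eq ▸ h.ell_le)
  have hx0 : f xInit - f σ.x0 ≤ gap f xInit := sub_le_sub_left (ciInf_le hbdd _) _
  set l := ellBar ellInit α L
  set Δ := gap f xInit with hΔdef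
  set a := c₁ α β
  set b := c₂ ellInit α L
  -- the current epoch counts as one more unsuccessful epoch
  obtain ⟨i, -, hi⟩ := Finset.exists_min_image (Finset.range (σ.k + 1))
    (fun j => f (pos f σ.ell σ.x0 j)) ⟨0, by simp⟩
  have hlast := h.unfinished.sq_le_decrease hell hε (y := pos f σ.ell σ.x0 i)
    (fun j hj => hi j (Finset.mem_range.2 (by omega)))
  have hi0 : f (pos f σ.ell σ.x0 i) ≤ f σ.x0 := hi 0 (by simp)
  have hilow : f xInit - f (pos f σ.ell σ.x0 i) ≤ Δ := sub_le_sub_left (ciInf_le hbdd _) _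
  have hQ : (Q + (σ.k : ℝ) ^ 2) * ε ^ 2 ≤ 64 / 3 * l * Δ := by
    have h1 := h.squares_le
    have h2 := mul_le_mul_of_nonneg_right h.ell_le (sub_nonneg.2 hi0)
    have h3 := mul_le_mul_of_nonneg_left hilow hlmax.le
    linarith
  have hM := sq_add_le_succ_mul (m := (σ.k : ℝ)) (Nat.cast_nonneg n) h.nonneg h.sq_le
  have hN : (N : ℝ) ≤ 608 / 3 * G * Δ :=
    h.number_le.trans (mul_le_mul_of_nonneg_left hx0 (by positivity))
  have hA : A ≤ 88 * (√l * √G / ε) * Δ := by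
    rw [← Real.sqrt_mul hlmax.le]
    exact h.successful_le.trans (mul_le_mul_of_nonneg_left hx0 (by positivity))
  have haN : a * N ≤ a * (608 / 3 * G * Δ) := mul_le_mul_of_nonneg_left hN hc₁
  have hbΔ : 0 ≤ b * Δ * l := by positivity
  have hsq : ((M + σ.k) * ε) ^ 2 ≤ (6 * √(b * Δ * l) + 91 * √a * Δ * (√l * √G)) ^ 2 := by
    have e1 : (6 * √(b * Δ * l)) ^ 2 = 36 * (b * Δ * l) := by
      rw [mul_pow, Real.sq_sqrt hbΔ]; norm_num
    have e2 : (91 * √a * Δ * (√l * √G)) ^ 2 = 8281 * a * Δ ^ 2 * (l * G) := by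
      rw [mul_pow, mul_pow, mul_pow, mul_pow, Real.sq_sqrt hc₁, Real.sq_sqrt hlmax.le,
        Real.sq_sqrt hG]
      norm_num
    have e3 : 0 ≤ 2 * (6 * √(b * Δ * l)) * (91 * √a * Δ * (√l * √G)) := by positivity
    have e4 : ((M + σ.k) * ε) ^ 2 ≤ (n + 1) * (64 / 3 * l * Δ) := by
      rw [mul_pow]
      calc _ ≤ ((n : ℝ) + 1) * (Q + (σ.k : ℝ) ^ 2) * ε ^ 2 := by gcongr
        _ = ((n : ℝ) + 1) * ((Q + (σ.k : ℝ) ^ 2) * ε ^ 2) := by ring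
        _ ≤ _ := by gcongr
    have e5 : ((n : ℝ) + 1) * (64 / 3 * l * Δ) ≤
        (b + a * (608 / 3 * G * Δ)) * (64 / 3 * l * Δ) :=
      mul_le_mul_of_nonneg_right (by linarith) (by positivity)
    have e6 : 0 ≤ a * Δ ^ 2 * (l * G) := by positivity
    rw [add_sq, e1, e2]
    nlinarith
  have hroot := abs_le_of_sq_le_sq' hsq (by positivity) |>.2
  have hMk : M + σ.k ≤ 6 * √(b * Δ * l) * ε⁻¹ + 91 * √a * Δ * √l * (√G / ε) := by
    rw [← le_div_iff₀ hε] at hroot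
    refine hroot.trans_eq ?_
    field_simp
  have haGΔ : 0 ≤ a * Δ * G := by positivity
  have hlast' : 0 ≤ √l * (√G / ε) * Δ := by positivity
  rw [iterationBound, h.count]
  have hA' : A ≤ 91 * Δ * √l * (√G / ε) := by
    refine hA.trans ?_
    rw [mul_div_assoc]
    linarith
  linarith

/-- If no pass up to the `J`-th one has produced a gradient of norm at most `ε`, then `J + 1` obeys
the bound. -/
theorem IsRun.succ_le_iterationBound {xInit : EuclideanSpace ℝ (Fin d)} {ellInit α β L ε H ν : ℝ}
    {s : ℕ → State d} (hs : IsRun f xInit ellInit α β s)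
    (hf : Differentiable ℝ f) (hg : Differentiable ℝ (∇ f))
    (hLip : ∀ x y, ‖∇ f x - ∇ f y‖ ≤ L * ‖x - y‖) (hbdd : BddBelow (Set.range f))
    (hinit : 0 < ellInit) (hα : 1 < α) (hβ0 : 0 < β) (hβ1 : β ≤ 1) (hε : 0 < ε)
    (hν : 0 ≤ ν) (hν1 : ν ≤ 1) (hH0 : 0 ≤ H) (hH : HolderHessian f H ν) (J : ℕ)
    (hJ : ∀ i, 1 ≤ i → i ≤ J → ε < ‖∇ f (runAvg f s i)‖) :
    (J : ℝ) + 1 ≤ iterationBound ellInit α β L (gap f xInit) ε (epochRate H ν ε) := by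
  have hledger : ∀ i ≤ J, ∃ (n N : ℕ) (A M Q : ℝ), Ledger f xInit ellInit α β (ellBar ellInit α L) ε
      (epochRate H ν ε) i (s i) n N A M Q := by
    intro i
    induction i with
    | zero =>
      intro _
      refine ⟨0, 0, 0, 0, 0, ?_⟩
      rw [hs.init]
      constructor <;> simp [ellBar, unfinished_zero]
    | succ i ih =>
      intro hi
      obtain ⟨n, N, A, M, Q, h⟩ := ih (by omega)
      exact h.step hf hg hLip hinit hα hβ0 hβ1 (le_max_right _ _) hε hν hν1 hH0 hH rfl (hs.step i)
        (hJ (i + 1) (by omega) hi)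
  obtain ⟨n, N, A, M, Q, h⟩ := hledger J le_rfl
  exact h.succ_le_iterationBound hbdd hinit hα hβ0 hβ1 hε (epochRate_nonneg hH0 hε)

end Run

/-! ### The Hölder constants and the two forms of the bound -/

section Final

variable {d : ℕ} {f : EuclideanSpace ℝ (Fin d) → ℝ}

theorem holderHessian_of_ne_top {ν : ℝ} (h : holderConst f ν ≠ ⊤) :
    HolderHessian f (holderConst f ν).toReal ν := by
  intro x y
  rcases eq_or_ne x y with rfl | hxy
  · rw [sub_self, norm_zero]
    positivity
  have h1 : ENNReal.ofReal (‖fderiv ℝ (∇ f) x - fderiv ℝ (∇ f) y‖ / ‖x - y‖ ^ ν) ≤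
      holderConst f ν :=
    le_iSup_of_le x (le_iSup_of_le y (le_iSup_of_le hxy le_rfl))
  have h2 : 0 < ‖x - y‖ ^ ν := Real.rpow_pos_of_pos (norm_pos_iff.2 (sub_ne_zero.2 hxy)) ν
  rwa [ENNReal.ofReal_le_iff_le_toReal h, div_le_iff₀ h2] at h1

/-- A Lipschitz gradient makes the Hölder constant with exponent `0` finite. -/
theorem holderConst_zero_le {L : ℝ} (hL : 0 ≤ L)
    (hLip : ∀ x y, ‖∇ f x - ∇ f y‖ ≤ L * ‖x - y‖) : holderConst f 0 ≤ ENNReal.ofReal (2 * L) := by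
  refine iSup_le fun x => iSup_le fun y => iSup_le fun _ => ENNReal.ofReal_le_ofReal ?_
  have hb : ∀ x, ‖fderiv ℝ (∇ f) x‖ ≤ L := fun x =>
    norm_fderiv_le_of_lip' ℝ hL (Filter.Eventually.of_forall fun y => hLip y x)
  rw [Real.rpow_zero, div_one]
  linarith [norm_sub_le (fderiv ℝ (∇ f) x) (fderiv ℝ (∇ f) y), hb x, hb y]

theorem sqrt_epochRate_div {H ν ε : ℝ} (hν : 0 ≤ ν) (hH : 0 ≤ H) (hε : 0 < ε) :
    √(epochRate H ν ε) / ε =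
      H ^ (1 / (2 + 2 * ν)) * ε ^ (-((4 + 3 * ν) / (2 + 2 * ν))) := by
  have h1 : 1 + ν ≠ 0 := by linarith
  have h2 : 2 + 2 * ν ≠ 0 := by linarith
  rw [epochRate, Real.sqrt_eq_rpow, Real.mul_rpow (by positivity) (by positivity),
    ← Real.rpow_mul hH, ← Real.rpow_mul hε.le, mul_div_assoc, ← Real.rpow_sub_one hε.ne']
  congr 2
  · field_simp
  · field_simp
    ring

theorem ofReal_mul_rpow_mul {h : ℝ≥0∞} (hh : h ≠ ⊤) {c p e : ℝ} (hc : 0 ≤ c) (hp : 0 ≤ p) :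
    ENNReal.ofReal c * h ^ p * ENNReal.ofReal e = ENNReal.ofReal (c * (h.toReal ^ p * e)) := by
  conv_lhs => rw [← ENNReal.ofReal_toReal hh]
  rw [ENNReal.ofReal_rpow_of_nonneg ENNReal.toReal_nonneg hp, mul_assoc,
    ← ENNReal.ofReal_mul (by positivity), ← ENNReal.ofReal_mul hc]

/-- A bound by `iterationBound` for every exponent with a finite Hölder constant gives the bound by
the infimum. If `Δ = 0`, an exponent with an infinite constant makes the product `0 * ∞ = 0` in
`ℝ≥0∞`; then the bound for the exponent `0` applies, whose leading terms vanish too. -/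
theorem natCast_le_iInf {L ellInit α β ε Δ : ℝ} {h : ℝ → ℝ≥0∞} (hinit : 0 < ellInit) (hα : 1 < α)
    (hβ0 : 0 < β) (hβ1 : β ≤ 1) (hε : 0 < ε) (hΔ : 0 ≤ Δ) (hh0 : h 0 ≠ ⊤) {K : ℕ}
    (hK : ∀ ν ∈ Set.Icc (0 : ℝ) 1, h ν ≠ ⊤ →
      (K : ℝ) ≤ iterationBound ellInit α β L Δ ε (epochRate (h ν).toReal ν ε)) :
    (K : ℝ≥0∞) ≤
      (⨅ ν ∈ Set.Icc (0 : ℝ) 1,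
        (ENNReal.ofReal (91 * (1 + √(c₁ α β)) * Δ * √(ellBar ellInit α L)) *
            h ν ^ (1 / (2 + 2 * ν)) * ENNReal.ofReal (ε ^ (-((4 + 3 * ν) / (2 + 2 * ν)))) +
          ENNReal.ofReal (256 * c₁ α β * Δ) * h ν ^ (1 / (1 + ν)) *
            ENNReal.ofReal (ε ^ (-((2 + ν) / (1 + ν)))))) +
        ENNReal.ofReal
          (6 * √(c₂ ellInit α L * Δ * ellBar ellInit α L) * ε⁻¹ + c₂ ellInit α L) := by
  have hc₁ := c₁_nonneg hα hβ0 hβ1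
  have hc₂ := one_le_c₂ (L := L) hinit hα
  have hl : 0 < ellBar ellInit α L := ellBar_pos hinit
  rw [← tsub_le_iff_right]
  refine le_iInf₂ fun ν hν => tsub_le_iff_right.2 ?_
  have hν0 : 0 ≤ ν := hν.1
  by_cases htop : h ν = ⊤
  · rcases hΔ.eq_or_lt with h0 | hpos
    · have h1 := hK 0 ⟨le_rfl, zero_le_one⟩ hh0
      rw [← h0] at h1 ⊢
      simp only [iterationBound, mul_zero, zero_mul, zero_add] at h1
      refine le_add_left ?_
      rw [← ENNReal.ofReal_natCast]
      refine ENNReal.ofReal_le_ofReal (h1.trans_eq ?_)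
      simp
    · have h1 : ENNReal.ofReal (91 * (1 + √(c₁ α β)) * Δ * √(ellBar ellInit α L)) ≠ 0 :=
        (ENNReal.ofReal_pos.2 (by positivity)).ne'
      have h2 : ENNReal.ofReal (ε ^ (-((4 + 3 * ν) / (2 + 2 * ν)))) ≠ 0 :=
        (ENNReal.ofReal_pos.2 (by positivity)).ne'
      rw [htop, ENNReal.top_rpow_of_pos (by positivity), ENNReal.mul_top h1, ENNReal.top_mul h2,
        top_add, top_add]
      exact le_top
  · have h1 := hK ν hν htop
    rw [iterationBound, sqrt_epochRate_div hν0 ENNReal.toReal_nonneg hε] at h1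
    rw [ofReal_mul_rpow_mul htop (by positivity) (by positivity),
      ofReal_mul_rpow_mul htop (by positivity) (by positivity),
      ← ENNReal.ofReal_add (by positivity) (by positivity),
      ← ENNReal.ofReal_add (by positivity) (by positivity), ← ENNReal.ofReal_natCast]
    exact ENNReal.ofReal_le_ofReal h1

open Filter Topology in
/-- As `ε → 0` the leading term dominates: `ε √G` stays below `√(2 L)`, because it tends to `0` for
`ν > 0` and because `H ≤ 2 L` for `ν = 0`, and `√G` tends to infinity. -/
theorem eventually_iterationBound_le {L ellInit α β Δ H ν : ℝ} (hL : 0 < L) (hinit : 0 < ellInit)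
    (hα : 1 < α) (hβ0 : 0 < β) (hβ1 : β ≤ 1) (hΔ : 0 ≤ Δ) (hν : 0 ≤ ν) (hH : 0 < H)
    (hH2 : ν = 0 → H ≤ 2 * L) :
    ∀ᶠ ε in 𝓝[>] (0 : ℝ), iterationBound ellInit α β L Δ ε (epochRate H ν ε) ≤
      (91 * (1 + √(c₁ α β)) * Δ * √(ellBar ellInit α L) + 256 * c₁ α β * Δ * √(2 * L) + 1) *
        (√(epochRate H ν ε) / ε) := by
  have hc₁ := c₁_nonneg hα hβ0 hβ1
  have hc₂ := one_le_c₂ (L := L) hinit hα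
  have hν1 : 0 < 1 + ν := by linarith
  have hsmall : ∀ᶠ ε in 𝓝[>] (0 : ℝ), ε ^ 2 * epochRate H ν ε ≤ 2 * L := by
    have e : ∀ ε : ℝ, 0 < ε → ε ^ 2 * epochRate H ν ε = H ^ (1 / (1 + ν)) * ε ^ (ν / (1 + ν)) := by
      intro ε hε
      have e1 : ε ^ (ν / (1 + ν)) = ε ^ 2 * ε ^ (-((2 + ν) / (1 + ν))) := by
        rw [← Real.rpow_natCast, ← Real.rpow_add hε]
        congr 1
        push_cast
        field_simp
        ring
      rw [e1, epochRate]
      ring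
    rcases hν.eq_or_lt with h0 | hpos
    · filter_upwards [self_mem_nhdsWithin] with ε hε
      rw [e ε hε, ← h0]
      simpa using hH2 h0.symm
    · have hlim : Tendsto (fun ε : ℝ => H ^ (1 / (1 + ν)) * ε ^ (ν / (1 + ν))) (𝓝[>] 0) (𝓝 0) := by
        have h1 : Tendsto (fun ε : ℝ => ε ^ (ν / (1 + ν))) (𝓝[>] 0) (𝓝 0) := by
          have := (Real.continuousAt_rpow_const 0 (ν / (1 + ν)) (Or.inr (by positivity))).tendsto
          rw [Real.zero_rpow (by positivity)] at this
          exact this.mono_left nhdsWithin_le_nhds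
        simpa using h1.const_mul (H ^ (1 / (1 + ν)))
      filter_upwards [self_mem_nhdsWithin, hlim.eventually_le_const (by positivity : 0 < 2 * L)]
        with ε hε h
      rw [e ε hε]
      exact h
  set B := 6 * √(c₂ ellInit α L * Δ * ellBar ellInit α L) + c₂ ellInit α L with hB
  have hbig : ∀ᶠ ε in 𝓝[>] (0 : ℝ), B ^ 2 ≤ epochRate H ν ε := by
    have h1 : Tendsto (fun ε : ℝ => ε ^ (-((2 + ν) / (1 + ν)))) (𝓝[>] 0) atTop :=
      tendsto_rpow_neg_nhdsGT_zero (neg_lt_zero.2 (by positivity))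
    exact (h1.const_mul_atTop (by positivity : 0 < H ^ (1 / (1 + ν)))).eventually_ge_atTop _
  have hone : ∀ᶠ ε in 𝓝[>] (0 : ℝ), ε ≤ 1 :=
    nhdsWithin_le_nhds (eventually_le_nhds zero_lt_one)
  filter_upwards [self_mem_nhdsWithin, hsmall, hbig, hone] with ε hε h1 h2 h3
  have hε : 0 < ε := hε
  set G := epochRate H ν ε
  have hG : 0 ≤ G := epochRate_nonneg hH.le hε
  have hG1 : G ≤ √(2 * L) * (√G / ε) := by
    have h4 : ε * √G ≤ √(2 * L) := Real.le_sqrt_of_sq_le (by rwa [mul_pow, Real.sq_sqrt hG])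
    have h5 := mul_le_mul_of_nonneg_right h4 (Real.sqrt_nonneg G)
    rw [mul_assoc, Real.mul_self_sqrt hG] at h5
    rw [mul_div_assoc', le_div_iff₀ hε]
    linarith
  have hB1 : 6 * √(c₂ ellInit α L * Δ * ellBar ellInit α L) * ε⁻¹ + c₂ ellInit α L ≤ √G / ε := by
    have h4 : B ≤ √G := Real.le_sqrt_of_sq_le h2
    rw [le_div_iff₀ hε, add_mul, mul_assoc, inv_mul_cancel₀ hε.ne', mul_one]
    have h5 : c₂ ellInit α L * ε ≤ c₂ ellInit α L := mul_le_of_le_one_right (by linarith) h3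
    linarith
  have h4 := mul_le_mul_of_nonneg_left hG1 (by positivity : 0 ≤ 256 * c₁ α β * Δ)
  rw [iterationBound]
  linarith

end Final

end HeavyBall

open HeavyBall in
theorem mainTheorem1
    (L ellInit α β : ℝ) (hL : 0 < L) (hinit : 0 < ellInit) (hα : 1 < α) (hβ0 : 0 < β) (hβ1 : β ≤ 1) :
    ∃ C : ℝ → ℝ, ∀ (d : ℕ) (f : EuclideanSpace ℝ (Fin d) → ℝ),
      Differentiable ℝ f → Differentiable ℝ (∇ f) →
      (∀ x y, ‖∇ f x - ∇ f y‖ ≤ L * ‖x - y‖) →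
      BddBelow (Set.range f) →
      ∀ (xInit : EuclideanSpace ℝ (Fin d)) (s : ℕ → State d), IsRun f xInit ellInit α β s →
        -- the explicit bound, in general and for `β = 1`
        (∀ ε : ℝ, 0 < ε → ∃ K : ℕ, IsFirstHit f s ε K ∧
          (K : ℝ≥0∞) ≤
            (⨅ ν ∈ Set.Icc (0 : ℝ) 1,
              (ENNReal.ofReal (91 * (1 + √(c₁ α β)) * gap f xInit * √(ellBar ellInit α L)) *
                  holderConst f ν ^ (1 / (2 + 2 * ν)) *
                  ENNReal.ofReal (ε ^ (-((4 + 3 * ν) / (2 + 2 * ν)))) +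
                ENNReal.ofReal (256 * c₁ α β * gap f xInit) *
                  holderConst f ν ^ (1 / (1 + ν)) *
                  ENNReal.ofReal (ε ^ (-((2 + ν) / (1 + ν)))))) +
              ENNReal.ofReal
                (6 * √(c₂ ellInit α L * gap f xInit * ellBar ellInit α L) * ε⁻¹ +
                  c₂ ellInit α L) ∧
          (β = 1 → c₁ α β = 0 ∧
            (K : ℝ≥0∞) ≤
              (⨅ ν ∈ Set.Icc (0 : ℝ) 1,
                ENNReal.ofReal (91 * gap f xInit * √(ellBar ellInit α L)) *
                  holderConst f ν ^ (1 / (2 + 2 * ν)) *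
                  ENNReal.ofReal (ε ^ (-((4 + 3 * ν) / (2 + 2 * ν))))) +
                ENNReal.ofReal
                  (6 * √(c₂ ellInit α L * gap f xInit * ellBar ellInit α L) * ε⁻¹ +
                    c₂ ellInit α L))) ∧
        -- the resulting order as `ε → 0`, for every `ν` at once
        (∀ ν ∈ Set.Icc (0 : ℝ) 1, holderConst f ν ≠ 0 → holderConst f ν ≠ ⊤ →
          ∃ ε₀ : ℝ, 0 < ε₀ ∧ ∀ ε : ℝ, 0 < ε → ε ≤ ε₀ → ∀ K : ℕ, IsFirstHit f s ε K →
            (K : ℝ≥0∞) ≤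
              ENNReal.ofReal (C (gap f xInit)) * holderConst f ν ^ (1 / (2 + 2 * ν)) *
                ENNReal.ofReal (ε ^ (-((4 + 3 * ν) / (2 + 2 * ν))))) := by
  refine ⟨fun Δ => 91 * (1 + √(c₁ α β)) * Δ * √(ellBar ellInit α L) +
    256 * c₁ α β * Δ * √(2 * L) + 1, ?_⟩
  intro d f hf hg hLip hbdd xInit s hs
  have hΔ := gap_nonneg hbdd xInit
  have hc₁ := c₁_nonneg hα hβ0 hβ1
  have hzero : holderConst f 0 ≤ ENNReal.ofReal (2 * L) := holderConst_zero_le hL.le hLip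
  have hzero_top : holderConst f 0 ≠ ⊤ := ne_top_of_le_ne_top ENNReal.ofReal_ne_top hzero
  have hJ : ∀ ε : ℝ, 0 < ε → ∀ ν ∈ Set.Icc (0 : ℝ) 1, holderConst f ν ≠ ⊤ → ∀ J : ℕ,
      (∀ i, 1 ≤ i → i ≤ J → ε < ‖∇ f (runAvg f s i)‖) →
      (J : ℝ) + 1 ≤ iterationBound ellInit α β L (gap f xInit) ε
        (epochRate (holderConst f ν).toReal ν ε) := fun ε hε ν hν hne J hu =>
    hs.succ_le_iterationBound hf hg hLip hbdd hinit hα hβ0 hβ1 hε hν.1 hν.2 ENNReal.toReal_nonneg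
      (holderHessian_of_ne_top hne) J hu
  have hhit : ∀ ε : ℝ, 0 < ε → ∀ K : ℕ, IsFirstHit f s ε K → ∀ ν ∈ Set.Icc (0 : ℝ) 1,
      holderConst f ν ≠ ⊤ → (K : ℝ) ≤ iterationBound ellInit α β L (gap f xInit) ε
        (epochRate (holderConst f ν).toReal ν ε) := by
    intro ε hε K hK ν hν hne
    obtain ⟨J, rfl⟩ := Nat.exists_eq_add_of_le' hK.1.1
    rw [Nat.cast_succ]
    refine hJ ε hε ν hν hne J fun i hi hiJ => ?_
    by_contra hc
    have := hK.2 ⟨hi, not_lt.1 hc⟩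
    omega
  refine ⟨fun ε hε => ?_, fun ν hν hne0 hne => ?_⟩
  · have hex : ∃ K : ℕ, 1 ≤ K ∧ ‖∇ f (runAvg f s K)‖ ≤ ε := by
      by_contra! hno
      obtain ⟨J, hJlt⟩ := exists_nat_gt (iterationBound ellInit α β L (gap f xInit) ε
        (epochRate (holderConst f 0).toReal 0 ε))
      have := hJ ε hε 0 ⟨le_rfl, zero_le_one⟩ hzero_top J fun i hi _ => hno i hi
      linarith
    classical
    have hfirst : IsFirstHit f s ε (Nat.find hex) :=
      ⟨Nat.find_spec hex, fun J hJ => Nat.find_min' hex hJ⟩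
    have hbound := natCast_le_iInf hinit hα hβ0 hβ1 hε hΔ hzero_top (hhit ε hε _ hfirst)
    refine ⟨Nat.find hex, hfirst, hbound, ?_⟩
    rintro rfl
    have hc : c₁ α 1 = 0 := by simp [c₁]
    refine ⟨hc, ?_⟩
    simpa only [hc, Real.sqrt_zero, add_zero, mul_one, mul_zero, zero_mul, ENNReal.ofReal_zero]
      using hbound
  · have hH : 0 < (holderConst f ν).toReal := ENNReal.toReal_pos hne0 hne
    have hev := eventually_iterationBound_le hL hinit hα hβ0 hβ1 hΔ hν.1 hH (by
      rintro rfl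
      exact ENNReal.toReal_le_of_le_ofReal (by positivity) hzero)
    obtain ⟨δ, hδ, hsub⟩ := mem_nhdsGT_iff_exists_Ioc_subset.1 hev
    refine ⟨δ, hδ, fun ε hε hεδ K hK => ?_⟩
    have h1 := (hhit ε hε K hK ν hν hne).trans (hsub ⟨hε, hεδ⟩)
    rw [sqrt_epochRate_div hν.1 hH.le hε] at h1
    have hν0 := hν.1
    rw [ofReal_mul_rpow_mul hne (by positivity) (by positivity), ← ENNReal.ofReal_natCast]
    exact ENNReal.ofReal_le_ofReal h1
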